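/- Let $K$ be a field of characteristic $0$, let $H=\bigoplus_{a\ge 0}H^a$ be a graded-commutative graded $K$-algebra, and let $m,n\ge 0$ be integers; the case of interest is $H=H^*(X;K)$ for a smooth complex projective variety $X$ of complex dimension $m$, $K=\mathbb Q$ or $\mathbb C$. Let $(x_h)_{h\in I}$ be a basis of $H$ consisting of homogeneous elements and indexed by a linearly ordered set $I$. The algebra $E(H,n)$ of the Križ model ($E(X,n)$ when $H=H^*(X;K)$) is the exterior algebra with generators $G_{ij}$, $1\le i\neq j\le n$, of degree $2m-1$, and coefficients in the graded tensor power $H^{\otimes n}$, modulo the relations $$G_{ji}=G_{ij},\qquad p_j^*(x)G_{ij}=p_i^*(x)G_{ij}\ (i<j,\ x\in H),\qquad G_{ik}G_{jk}=G_{ij}G_{jk}-G_{ij}G_{ik}\ (i<j<k),$$ where $p_i^*(x)$ is $x$ placed in the $i$-th tensor factor. The component $E_q^k(H,n)$ is spanned by the products $p_1^*(y_1)\cdots p_n^*(y_n)G_{i_1j_1}\cdots G_{i_qj_q}$ with homogeneous $y_i$ and $\sum_i\deg y_i+q(2m-1)=k$. The group $\mathcal S_n$ acts by algebra automorphisms with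 $\sigma(p_i^*(x))=p_{\sigma(i)}^*(x)$ and $\sigma(G_{ij})=G_{\sigma(i)\sigma(j)}$. A marked monotonic forest is a forest on the vertices $1,\dots,n$, with a mark in $I$ on every connected component, in which every vertex $j$ that is not the smallest of its component is joined to exactly one smaller vertex $i_j$. Its canonical monomial is $\prod_r p_r^*(x_{h_r})\prod_j G_{i_jj}$, where $r$ runs increasingly over the smallest vertices of the components, $h_r$ is the mark of the component of $r$, and $j$ runs increasingly over the other vertices. A type $(L_*,H_*)$ consists of positive integers $\lambda_1\ge\dots\ge\lambda_t$ with $\lambda_1+\dots+\lambda_t=n$ and marks $h_1,\dots,h_t\in I$ such that $h_i\ge h_{i+1}$ whenever $\lambda_i=\lambda_{i+1}$. Put $|L_*|=\sum_i(\lambda_i-1)$, $|H_*|=\sum_i\deg x_{h_i}$ and $L_i=\lambda_1+\dots+\lambda_i$ ($L_0=0$). The associated forest of marked bamboos is the disjoint union of the paths $L_{i-1}+1,\,L_{i-1}+2,\,\dots,\,L_i$ with marks $h_i$. A marked monotonic forest is of type $(L_*,H_*)$ if some permutation of $\{1,\dots,n\}$ induces a bijection from its components onto those of this forest of bamboos,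 preserving the numbers of vertices and the marks. Let $E(L_*,H_*)$ be the span of the canonical monomials of the marked monotonic forests of type $(L_*,H_*)$. **Theorem.** (1) For all integers $q\ge 0$ and $k$, $$E_q^k(H,n)=\bigoplus_{|L_*|=q,\ |H_*|=k-q(2m-1)}E(L_*,H_*).$$ (2) Each $E(L_*,H_*)$ is an $\mathcal S_n$-submodule, and it is monogenic: it is generated as a $K[\mathcal S_n]$-module by the canonical monomial of the forest of marked bamboos of type $(L_*,H_*)$. (3) Each $E(L_*,H_*)$ is a finite direct sum of irreducible $\mathcal S_n$-submodules, and in any such decomposition every irreducible $K[\mathcal S_n]$-module $V$ occurs (up to isomorphism) at most $\dim_K V$ times; in particular the multiplicity $m_\lambda$ of $V(\lambda)$ satisfies $m_\lambda\le\dim V(\lambda)$ for every partition $\lambda$ of $n$. -/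

import Mathlib

namespace Kriz

section Algebra

variable {K : Type*} [Field K] {H : Type*} [Ring H] [Algebra K H]

/-- Generators of the model on `n` points: the pullbacks `p_i^*(x)` of the classes `x` of `H` and
the exterior generators `G_{ij}`. -/
inductive Gen (H : Type*) (n : ℕ) : Type _
  | p (i : Fin n) (x : H) : Gen H n
  | G (i j : Fin n) : Gen H n

/-- The defining relations of the model, for a graded algebra `H = ⨁ 𝒜 a`. The first five say that
the `p_i^*(x)` generate a copy of the graded tensor power `H^{⊗ n}`; the next five that the `G_{ij}`
(`i ≠ j`, `G_{ji} = G_{ij}`, of odd degree `2m - 1`) are exterior generators over this graded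
algebra; the last two are the relations `p_j^*(x) G_{ij} = p_i^*(x) G_{ij}` and
`G_{ik} G_{jk} = G_{ij} G_{jk} - G_{ij} G_{ik}`. -/
inductive Rel (𝒜 : ℕ → Submodule K H) (n : ℕ) :
    FreeAlgebra K (Gen H n) → FreeAlgebra K (Gen H n) → Prop
  | p_add (i : Fin n) (x y : H) : Rel 𝒜 n (FreeAlgebra.ι K (.p i (x + y)))
      (FreeAlgebra.ι K (.p i x) + FreeAlgebra.ι K (.p i y))
  | p_smul (i : Fin n) (c : K) (x : H) : Rel 𝒜 n (FreeAlgebra.ι K (.p i (c • x)))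
      (c • FreeAlgebra.ι K (.p i x))
  | p_one (i : Fin n) : Rel 𝒜 n (FreeAlgebra.ι K (.p i 1)) 1
  | p_mul (i : Fin n) (x y : H) : Rel 𝒜 n (FreeAlgebra.ι K (.p i (x * y)))
      (FreeAlgebra.ι K (.p i x) * FreeAlgebra.ι K (.p i y))
  | p_comm (i j : Fin n) (hij : i ≠ j) (a b : ℕ) (x y : H) (hx : x ∈ 𝒜 a) (hy : y ∈ 𝒜 b) :
      Rel 𝒜 n (FreeAlgebra.ι K (.p i x) * FreeAlgebra.ι K (.p j y))
        ((-1) ^ (a * b) * (FreeAlgebra.ι K (.p j y) * FreeAlgebra.ι K (.p i x)))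
  | G_diag (i : Fin n) : Rel 𝒜 n (FreeAlgebra.ι K (.G i i)) 0
  | G_symm (i j : Fin n) : Rel 𝒜 n (FreeAlgebra.ι K (.G j i)) (FreeAlgebra.ι K (.G i j))
  | G_sq (i j : Fin n) : Rel 𝒜 n (FreeAlgebra.ι K (.G i j) * FreeAlgebra.ι K (.G i j)) 0
  | G_anticomm (i j k l : Fin n) :
      Rel 𝒜 n (FreeAlgebra.ι K (.G i j) * FreeAlgebra.ι K (.G k l))
        (-(FreeAlgebra.ι K (.G k l) * FreeAlgebra.ι K (.G i j)))
  | G_p_comm (i j k : Fin n) (a : ℕ) (x : H) (hx : x ∈ 𝒜 a) :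
      Rel 𝒜 n (FreeAlgebra.ι K (.G j k) * FreeAlgebra.ι K (.p i x))
        ((-1) ^ a * (FreeAlgebra.ι K (.p i x) * FreeAlgebra.ι K (.G j k)))
  | p_G (i j : Fin n) (hij : i < j) (x : H) :
      Rel 𝒜 n (FreeAlgebra.ι K (.p j x) * FreeAlgebra.ι K (.G i j))
        (FreeAlgebra.ι K (.p i x) * FreeAlgebra.ι K (.G i j))
  | arnold (i j k : Fin n) (hij : i < j) (hjk : j < k) :
      Rel 𝒜 n (FreeAlgebra.ι K (.G i k) * FreeAlgebra.ι K (.G j k))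
        (FreeAlgebra.ι K (.G i j) * FreeAlgebra.ι K (.G j k) -
          FreeAlgebra.ι K (.G i j) * FreeAlgebra.ι K (.G i k))

/-- The algebra `E(H, n)` underlying the Križ model. -/
abbrev Model (𝒜 : ℕ → Submodule K H) (n : ℕ) : Type _ := RingQuot (Rel 𝒜 n)

variable (𝒜 : ℕ → Submodule K H) {n : ℕ}

/-- The class `p_i^*(x)` in the model. -/
noncomputable def p (i : Fin n) (x : H) : Model 𝒜 n :=
  RingQuot.mkAlgHom K (Rel 𝒜 n) (FreeAlgebra.ι K (.p i x))

/-- The exterior generator `G_{ij}` in the model. -/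
noncomputable def G (i j : Fin n) : Model 𝒜 n :=
  RingQuot.mkAlgHom K (Rel 𝒜 n) (FreeAlgebra.ι K (.G i j))

lemma p_add (i : Fin n) (x y : H) : p 𝒜 i (x + y) = p 𝒜 i x + p 𝒜 i y := by
  simpa [p] using RingQuot.mkAlgHom_rel K (Rel.p_add (𝒜 := 𝒜) i x y)

lemma p_smul (i : Fin n) (c : K) (x : H) : p 𝒜 i (c • x) = c • p 𝒜 i x := by
  simpa [p] using RingQuot.mkAlgHom_rel K (Rel.p_smul (𝒜 := 𝒜) i c x)

lemma p_one (i : Fin n) : p 𝒜 i 1 = 1 := by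
  simpa [p] using RingQuot.mkAlgHom_rel K (Rel.p_one (𝒜 := 𝒜) i)

lemma p_mul (i : Fin n) (x y : H) : p 𝒜 i (x * y) = p 𝒜 i x * p 𝒜 i y := by
  simpa [p] using RingQuot.mkAlgHom_rel K (Rel.p_mul (𝒜 := 𝒜) i x y)

lemma p_comm {i j : Fin n} (hij : i ≠ j) {a b : ℕ} {x y : H} (hx : x ∈ 𝒜 a) (hy : y ∈ 𝒜 b) :
    p 𝒜 i x * p 𝒜 j y = (-1) ^ (a * b) * (p 𝒜 j y * p 𝒜 i x) := by
  simpa [p] using RingQuot.mkAlgHom_rel K (Rel.p_comm (𝒜 := 𝒜) i j hij a b x y hx hy)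

lemma G_diag (i : Fin n) : G 𝒜 i i = 0 := by
  simpa [G] using RingQuot.mkAlgHom_rel K (Rel.G_diag (𝒜 := 𝒜) i)

lemma G_symm (i j : Fin n) : G 𝒜 j i = G 𝒜 i j := by
  simpa [G] using RingQuot.mkAlgHom_rel K (Rel.G_symm (𝒜 := 𝒜) i j)

lemma G_sq (i j : Fin n) : G 𝒜 i j * G 𝒜 i j = 0 := by
  simpa [G] using RingQuot.mkAlgHom_rel K (Rel.G_sq (𝒜 := 𝒜) i j)

lemma G_anticomm (i j k l : Fin n) : G 𝒜 i j * G 𝒜 k l = -(G 𝒜 k l * G 𝒜 i j) := by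
  simpa [G] using RingQuot.mkAlgHom_rel K (Rel.G_anticomm (𝒜 := 𝒜) i j k l)

lemma G_p_comm (i j k : Fin n) {a : ℕ} {x : H} (hx : x ∈ 𝒜 a) :
    G 𝒜 j k * p 𝒜 i x = (-1) ^ a * (p 𝒜 i x * G 𝒜 j k) := by
  simpa [G, p] using RingQuot.mkAlgHom_rel K (Rel.G_p_comm (𝒜 := 𝒜) i j k a x hx)

lemma p_G (i j : Fin n) (x : H) : p 𝒜 j x * G 𝒜 i j = p 𝒜 i x * G 𝒜 i j := by
  have key (i j : Fin n) (h : i < j) : p 𝒜 j x * G 𝒜 i j = p 𝒜 i x * G 𝒜 i j := by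
    simpa [G, p] using RingQuot.mkAlgHom_rel K (Rel.p_G (𝒜 := 𝒜) i j h x)
  rcases lt_trichotomy i j with h | h | h
  · exact key i j h
  · rw [h]
  · rw [G_symm 𝒜 j i]; exact (key j i h).symm

lemma arnold_of_lt {i j k : Fin n} (hij : i < j) (hjk : j < k) :
    G 𝒜 i k * G 𝒜 j k = G 𝒜 i j * G 𝒜 j k - G 𝒜 i j * G 𝒜 i k := by
  simpa [G] using RingQuot.mkAlgHom_rel K (Rel.arnold (𝒜 := 𝒜) i j k hij hjk)

lemma arnold {i j k : Fin n} (hij : i ≠ j) (hjk : j ≠ k) (hik : i ≠ k) :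
    G 𝒜 i k * G 𝒜 j k = G 𝒜 i j * G 𝒜 j k - G 𝒜 i j * G 𝒜 i k := by
  have e1 := G_symm 𝒜 i j
  have e2 := G_symm 𝒜 j k
  have e3 := G_symm 𝒜 i k
  have c1 := G_anticomm 𝒜 i j j k
  have c2 := G_anticomm 𝒜 i j i k
  have c3 := G_anticomm 𝒜 j k i k
  rcases lt_or_gt_of_ne hij with h1 | h1 <;> rcases lt_or_gt_of_ne hjk with h2 | h2 <;>
    rcases lt_or_gt_of_ne hik with h3 | h3
  · exact arnold_of_lt 𝒜 h1 h2
  · exact absurd (h1.trans h2) h3.asymm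
  · have := arnold_of_lt 𝒜 h3 h2
    grind
  · have := arnold_of_lt 𝒜 h3 h1
    grind
  · have := arnold_of_lt 𝒜 h1 h3
    grind
  · have := arnold_of_lt 𝒜 h2 h3
    grind
  · exact absurd (h2.trans h1) h3.asymm
  · have := arnold_of_lt 𝒜 h2 h1
    grind

/-- The value on generators of the action of a permutation. -/
noncomputable def permGen (σ : Equiv.Perm (Fin n)) : Gen H n → Model 𝒜 n
  | .p i x => p 𝒜 (σ i) x
  | .G i j => G 𝒜 (σ i) (σ j)

lemma permGen_rel (σ : Equiv.Perm (Fin n)) ⦃a b : FreeAlgebra K (Gen H n)⦄ (h : Rel 𝒜 n a b) :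
    FreeAlgebra.lift K (permGen 𝒜 σ) a = FreeAlgebra.lift K (permGen 𝒜 σ) b := by
  induction h with
  | p_add i x y => simpa [permGen] using p_add 𝒜 _ x y
  | p_smul i c x => simpa [permGen] using p_smul 𝒜 _ c x
  | p_one i => simpa [permGen] using p_one 𝒜 _
  | p_mul i x y => simpa [permGen] using p_mul 𝒜 _ x y
  | p_comm i j hij a b x y hx hy =>
    simpa [permGen] using p_comm 𝒜 (σ.injective.ne hij) hx hy
  | G_diag i => simpa [permGen] using G_diag 𝒜 _
  | G_symm i j => simpa [permGen] using G_symm 𝒜 _ _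
  | G_sq i j => simpa [permGen] using G_sq 𝒜 _ _
  | G_anticomm i j k l => simpa [permGen] using G_anticomm 𝒜 _ _ _ _
  | G_p_comm i j k a x hx => simpa [permGen] using G_p_comm 𝒜 _ _ _ hx
  | p_G i j hij x => simpa [permGen] using p_G 𝒜 _ _ x
  | arnold i j k hij hjk =>
    simpa [permGen] using arnold 𝒜 (σ.injective.ne hij.ne) (σ.injective.ne hjk.ne)
      (σ.injective.ne (hij.trans hjk).ne)

/-- The algebra endomorphism of the model with `p_i^*(x) ↦ p_{σ i}^*(x)`,
`G_{ij} ↦ G_{σ i, σ j}`. -/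
noncomputable def permHom (σ : Equiv.Perm (Fin n)) : Model 𝒜 n →ₐ[K] Model 𝒜 n :=
  RingQuot.liftAlgHom K ⟨FreeAlgebra.lift K (permGen 𝒜 σ), permGen_rel 𝒜 σ⟩

@[simp] lemma permHom_p (σ : Equiv.Perm (Fin n)) (i : Fin n) (x : H) :
    permHom 𝒜 σ (p 𝒜 i x) = p 𝒜 (σ i) x := by
  simp [permHom, p, permGen]

@[simp] lemma permHom_G (σ : Equiv.Perm (Fin n)) (i j : Fin n) :
    permHom 𝒜 σ (G 𝒜 i j) = G 𝒜 (σ i) (σ j) := by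
  simp [permHom, G, permGen]

lemma algHom_ext {f g : Model 𝒜 n →ₐ[K] Model 𝒜 n} (hp : ∀ i x, f (p 𝒜 i x) = g (p 𝒜 i x))
    (hG : ∀ i j, f (G 𝒜 i j) = g (G 𝒜 i j)) : f = g := by
  apply RingQuot.ringQuot_ext'
  apply FreeAlgebra.hom_ext
  funext t
  cases t with
  | p i x => exact hp i x
  | G i j => exact hG i j

variable (n) in
/-- The action of the symmetric group `S_n` on the model. -/
noncomputable def action : Representation K (Equiv.Perm (Fin n)) (Model 𝒜 n) where
  toFun σ := (permHom 𝒜 σ).toLinearMap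
  map_one' := by
    have : permHom 𝒜 (1 : Equiv.Perm (Fin n)) = AlgHom.id K _ := algHom_ext 𝒜 (by simp) (by simp)
    rw [this]; rfl
  map_mul' σ τ := by
    have : permHom 𝒜 (σ * τ) = (permHom 𝒜 σ).comp (permHom 𝒜 τ) :=
      algHom_ext 𝒜 (by simp) (by simp)
    rw [this]; rfl

/-- The bihomogeneous component `E_q^k`, of exterior degree `q` and total degree `k`: the span of
the products `p_1^*(y_1) ⋯ p_n^*(y_n) G_{i_1 j_1} ⋯ G_{i_q j_q}` with `y_i` homogeneous of degree
`d_i` and `∑ d_i + q (2m - 1) = k`. -/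
def component (m n q : ℕ) (k : ℤ) : Submodule K (Model 𝒜 n) :=
  Submodule.span K {e | ∃ (y : Fin n → H) (d : Fin n → ℕ) (L : List (Fin n × Fin n)),
    (∀ i, y i ∈ 𝒜 (d i)) ∧ L.length = q ∧ (∑ i, d i : ℤ) + q * (2 * m - 1) = k ∧
    e = (List.ofFn fun i => p 𝒜 i (y i)).prod * (L.map fun a => G 𝒜 a.1 a.2).prod}

end Algebra

section Forests

/-- A marked monotonic forest on the vertices `1 < ⋯ < n`: every vertex `j` which is not minimal in
its component is joined to exactly one smaller vertex `parent j`, and every component carries a mark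
in `ι`. The mark is recorded at all the vertices of the component. These are the index data
`(H_*, I_*, J_*)` of the canonical basis: `J_*` consists of the vertices having a parent, in
increasing order, and `I_*` of their parents. -/
@[ext]
structure MarkedForest (n : ℕ) (ι : Type*) where
  parent : Fin n → Option (Fin n)
  parent_lt : ∀ i j, parent j = some i → i < j
  mark : Fin n → ι
  mark_parent : ∀ i j, parent j = some i → mark j = mark i

variable {n : ℕ} {ι : Type*}

/-- The underlying graph, with an edge for every factor `G_{ij}`. -/
def MarkedForest.graph (F : MarkedForest n ι) : SimpleGraph (Fin n) :=
  SimpleGraph.fromRel fun i j => F.parent j = some i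

/-- Two marked forests are of the same type if some permutation of the vertices induces a bijection
between their connected components which preserves the numbers of vertices and the marks. -/
def SameType (F F' : MarkedForest n ι) : Prop :=
  ∃ σ : Equiv.Perm (Fin n), (∀ i j, F.graph.Reachable i j ↔ F'.graph.Reachable (σ i) (σ j)) ∧
    ∀ i, F'.mark (σ i) = F.mark i

/-- A type `(L_*, H_*)`: lengths `len 0 ≥ len 1 ≥ ⋯` of bamboos, of sum `n`, with marks, the marks
of bamboos of equal length being in decreasing order. -/
structure ForestType (n : ℕ) (ι : Type*) [LinearOrder ι] where
  t : ℕ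
  len : Fin t → ℕ
  mark : Fin t → ι
  len_pos : ∀ i, 0 < len i
  sum_len : ∑ i, len i = n
  len_anti : ∀ i j, i ≤ j → len j ≤ len i
  mark_anti : ∀ i j, i ≤ j → len i = len j → mark j ≤ mark i

namespace ForestType

variable [LinearOrder ι]

/-- `|L_*| = ∑ (λ_i - 1)`. -/
def lenDegree (T : ForestType n ι) : ℕ := ∑ i, (T.len i - 1)

/-- `|H_*| = ∑ deg x_{h_i}`. -/
def markDegree (T : ForestType n ι) (deg : ι → ℕ) : ℕ := ∑ i, deg (T.mark i)

/-- The vertices, listed bamboo by bamboo: `⟨i, a⟩` is the vertex `λ_1 + ⋯ + λ_{i-1} + a`. -/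
def vertex (T : ForestType n ι) : (Σ i : Fin T.t, Fin (T.len i)) ≃ Fin n :=
  finSigmaFinEquiv.trans (finCongr T.sum_len)

/-- The vertex before `⟨i, a⟩` on its bamboo. -/
def prev (T : ForestType n ι) (s : Σ i : Fin T.t, Fin (T.len i)) : Option (Fin n) :=
  if (s.2 : ℕ) = 0 then none else some (T.vertex ⟨s.1, ⟨s.2 - 1, by omega⟩⟩)

lemma prev_eq_some (T : ForestType n ι) {s : Σ i : Fin T.t, Fin (T.len i)} {v : Fin n}
    (h : T.prev s = some v) :
    v < T.vertex s ∧ (T.vertex.symm v).1 = s.1 := by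
  unfold prev at h
  split_ifs at h with h0
  obtain rfl := Option.some.inj h
  refine ⟨?_, by simp⟩
  rw [Fin.lt_def]
  simp only [vertex, Equiv.trans_apply, finCongr_apply, Fin.val_cast, finSigmaFinEquiv_apply]
  omega

/-- The forest of marked monotonic bamboos `(Γ_{L_*}, H_*)`: the `i`-th bamboo is the path
`L_{i-1}+1, L_{i-1}+2, …, L_i`, with mark `h_i`. -/
def bamboo (T : ForestType n ι) : MarkedForest n ι where
  parent v := T.prev (T.vertex.symm v)
  parent_lt i j h := by simpa using (T.prev_eq_some h).1
  mark v := T.mark (T.vertex.symm v).1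
  mark_parent i j h := by rw [(T.prev_eq_some h).2]

end ForestType

end Forests

section Types

variable {K : Type*} [Field K] {H : Type*} [Ring H] [Algebra K H] (𝒜 : ℕ → Submodule K H)
  {n : ℕ} {ι : Type*}

/-- The canonical monomial `x_{H_*} G_{I_* J_*}` of a marked monotonic forest: the class `x_h` of the
mark of each component is put at its minimal vertex (the other vertices carry the class `1`), and
the factors `G_{ij}`, `i` the parent of `j`, are ordered by increasing `j`. -/
noncomputable def monomial (x : ι → H) (F : MarkedForest n ι) : Model 𝒜 n :=
  (List.ofFn fun v => if F.parent v = none then p 𝒜 v (x (F.mark v)) else 1).prod *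
    (List.ofFn fun j => match F.parent j with
      | none => 1
      | some i => G 𝒜 i j).prod

variable [LinearOrder ι]

/-- The subspace `E(L_*, H_*)`: the span of the canonical monomials of type `(L_*, H_*)`. -/
def typeSubspace (x : ι → H) (T : ForestType n ι) : Submodule K (Model 𝒜 n) :=
  Submodule.span K {e | ∃ F : MarkedForest n ι, SameType F T.bamboo ∧ e = monomial 𝒜 x F}

end Types

/-- `M` is the direct sum of the irreducible subrepresentations `W 0, …, W (r - 1)` of `ρ`. -/
structure IsIrreducibleDecomposition {K G E : Type*} [Field K] [Group G] [AddCommGroup E]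
    [Module K E] (ρ : Representation K G E) (M : Submodule K E) {r : ℕ}
    (W : Fin r → Subrepresentation ρ) : Prop where
  irreducible : ∀ i, (W i).toRepresentation.IsIrreducible
  indep : iSupIndep fun i => (W i).toSubmodule
  iSup_eq : ⨆ i, (W i).toSubmodule = M

/-- The multiplicity of the representation `θ` in a direct sum of the `W i`: the number of the
summands which are isomorphic to `θ`. -/
noncomputable def multiplicity {K G E V : Type*} [Field K] [Group G] [AddCommGroup E]
    [Module K E] [AddCommGroup V] [Module K V] {ρ : Representation K G E} {r : ℕ}
    (W : Fin r → Subrepresentation ρ) (θ : Representation K G V) : ℕ :=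
  Nat.card {i : Fin r // Nonempty ((W i).toRepresentation.Equiv θ)}

end Kriz

/-!
The proof has three parts.

*Independence.* The canonical monomials of all marked monotonic forests are linearly independent
(`linearIndependent_monomial`). If `A` is the model on `n` points, the model on `n + 1` points is
expected to be `A ⊗ H ⊕ A ^ n`, with summands `A * p_{n+1}^*(H)` and `A * G_{i,n+1}`. This space
(`ModelRing.Extension`) carries operators for all the generators of the model on `n + 1` points, and
they satisfy the defining relations (`ModelRing.extensionGen_rel`); no spanning result is needed for
this. A canonical monomial acts on the element standing for `1` by moving it to the tensor product
of a smaller monomial and a basis vector of `H`, or to a smaller monomial in one of the summands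
`A`, up to sign. So independence follows by induction on `n`. As every marked forest has exactly
one type (`exists_forestType`, `forestType_unique`), the type subspaces are independent.

*Straightening.* All spanning statements concern subspaces that are spanned by monomials, and signs
are irrelevant to them. The lines spanned by the generators commute with each other, so they can be
computed with in a commutative idempotent semiring (`exists_semiring_system`), in which the relation
of Arnold reads `g i k * g j k ≤ g i j * g j k + g i j * g i k`. There, a product over arbitrary
edges lies below products over monotonic forests with the same components and the same number of
edges (`ArnoldSystem.below_prod`): an edge added at a vertex which already has a parent is moved to
smaller vertices. As classes of `H` can be moved within the components and collected at the roots,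
this gives the spanning of the bihomogeneous components (`component_le_iSup`) and the stability of
the type subspaces (`action_mem_typeSubspace`). The same relation turns any tree into paths that
start at its root (`ArnoldSystem.below_edgeProd_paths`), and a system of marked paths is a translate
of the forest of bamboos; hence the type subspaces are cyclic (`span_orbit_bamboo`).

*Representation theory.* A cyclic representation of a finite group is finite-dimensional, and in
characteristic `0` it is semisimple (`exists_isIrreducibleDecomposition`). Given a decomposition and
an irreducible representation `V`, the components of the generator in the summands isomorphic to
`V`, carried to `V`, are linearly independent: a relation between them would be an equivariant map
to `V` which kills the generator. So there are at most `dim V` of them (`multiplicity_le_finrank`).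
-/

namespace Kriz

/-! ### The ring structure and the parity involution of the model -/

section Operations

variable {K : Type*} [Field K] {H : Type*} [Ring H] [Algebra K H] (𝒜 : ℕ → Submodule K H) (n : ℕ)

/-- The model `E(H, n)`, with all its operations derived from a single ring structure. (The
operations that `RingQuot` puts on `Model 𝒜 n` agree with these only after unfolding the two
semiring structures of a free algebra, so that lemmas such as `neg_mul` do not rewrite there.) -/
def ModelRing : Type _ := Model 𝒜 n

noncomputable instance : Ring (ModelRing 𝒜 n) := inferInstanceAs (Ring (RingQuot (Rel 𝒜 n)))

noncomputable instance : Algebra K (ModelRing 𝒜 n) :=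
  inferInstanceAs (Algebra K (RingQuot (Rel 𝒜 n)))

namespace ModelRing

variable {n}

/-- The class `p_i^*(y)`. -/
noncomputable def p (i : Fin n) (y : H) : ModelRing 𝒜 n := Kriz.p 𝒜 i y

/-- The exterior generator `G_{ij}`. -/
noncomputable def G (i j : Fin n) : ModelRing 𝒜 n := Kriz.G 𝒜 i j

lemma p_add (i : Fin n) (x y : H) : p 𝒜 i (x + y) = p 𝒜 i x + p 𝒜 i y := Kriz.p_add 𝒜 i x y

lemma p_smul (i : Fin n) (c : K) (x : H) : p 𝒜 i (c • x) = c • p 𝒜 i x := Kriz.p_smul 𝒜 i c x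

lemma p_one (i : Fin n) : p 𝒜 i 1 = 1 := Kriz.p_one 𝒜 i

lemma p_mul (i : Fin n) (x y : H) : p 𝒜 i (x * y) = p 𝒜 i x * p 𝒜 i y := Kriz.p_mul 𝒜 i x y

lemma p_comm {i j : Fin n} (hij : i ≠ j) {a b : ℕ} {x y : H} (hx : x ∈ 𝒜 a) (hy : y ∈ 𝒜 b) :
    p 𝒜 i x * p 𝒜 j y = (-1) ^ (a * b) * (p 𝒜 j y * p 𝒜 i x) := Kriz.p_comm 𝒜 hij hx hy

lemma G_diag (i : Fin n) : G 𝒜 i i = 0 := Kriz.G_diag 𝒜 i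

lemma G_symm (i j : Fin n) : G 𝒜 j i = G 𝒜 i j := Kriz.G_symm 𝒜 i j

lemma G_sq (i j : Fin n) : G 𝒜 i j * G 𝒜 i j = 0 := Kriz.G_sq 𝒜 i j

lemma G_anticomm (i j k l : Fin n) : G 𝒜 i j * G 𝒜 k l = -(G 𝒜 k l * G 𝒜 i j) :=
  Kriz.G_anticomm 𝒜 i j k l

lemma G_p_comm (i j k : Fin n) {a : ℕ} {x : H} (hx : x ∈ 𝒜 a) :
    G 𝒜 j k * p 𝒜 i x = (-1) ^ a * (p 𝒜 i x * G 𝒜 j k) := Kriz.G_p_comm 𝒜 i j k hx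

lemma p_G (i j : Fin n) (x : H) : p 𝒜 j x * G 𝒜 i j = p 𝒜 i x * G 𝒜 i j := Kriz.p_G 𝒜 i j x

/-- The relation of Arnold holds for arbitrary indices: when two of them coincide, both sides
vanish or agree by anticommutativity. -/
lemma arnold (i j k : Fin n) :
    G 𝒜 i k * G 𝒜 j k = G 𝒜 i j * G 𝒜 j k - G 𝒜 i j * G 𝒜 i k := by
  rcases eq_or_ne i j with rfl | hij
  · simp [G_diag, G_sq]
  rcases eq_or_ne j k with rfl | hjk
  · simp [G_diag, G_sq]
  rcases eq_or_ne i k with rfl | hik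
  · simp [G_diag, G_symm 𝒜 j i, G_sq]
  exact Kriz.arnold 𝒜 hij hjk hik

variable {𝒜} in
/-- The universal property of the model. -/
noncomputable def lift {B : Type*} [Ring B] [Algebra K B] (f : Gen H n → B)
    (hf : ∀ ⦃a b⦄, Rel 𝒜 n a b → FreeAlgebra.lift K f a = FreeAlgebra.lift K f b) :
    ModelRing 𝒜 n →ₐ[K] B :=
  (RingQuot.liftAlgHom K ⟨FreeAlgebra.lift K f, hf⟩ : RingQuot (Rel 𝒜 n) →ₐ[K] B)

lemma lift_p {B : Type*} [Ring B] [Algebra K B] (f : Gen H n → B)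
    (hf : ∀ ⦃a b⦄, Rel 𝒜 n a b → FreeAlgebra.lift K f a = FreeAlgebra.lift K f b)
    (i : Fin n) (y : H) : lift f hf (p 𝒜 i y) = f (.p i y) := by
  have : (RingQuot.liftAlgHom K ⟨FreeAlgebra.lift K f, hf⟩ : RingQuot (Rel 𝒜 n) →ₐ[K] B)
      (Kriz.p 𝒜 i y) = f (.p i y) := by simp [Kriz.p]
  exact this

lemma lift_G {B : Type*} [Ring B] [Algebra K B] (f : Gen H n → B)
    (hf : ∀ ⦃a b⦄, Rel 𝒜 n a b → FreeAlgebra.lift K f a = FreeAlgebra.lift K f b)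
    (i j : Fin n) : lift f hf (G 𝒜 i j) = f (.G i j) := by
  have : (RingQuot.liftAlgHom K ⟨FreeAlgebra.lift K f, hf⟩ : RingQuot (Rel 𝒜 n) →ₐ[K] B)
      (Kriz.G 𝒜 i j) = f (.G i j) := by simp [Kriz.G]
  exact this

/-- Induction on the generators of the model. -/
lemma induction {P : ModelRing 𝒜 n → Prop} (halg : ∀ c, P (algebraMap K _ c))
    (hadd : ∀ a b, P a → P b → P (a + b)) (hmul : ∀ a b, P a → P b → P (a * b))
    (hp : ∀ i y, P (p 𝒜 i y)) (hG : ∀ i j, P (G 𝒜 i j)) (a : ModelRing 𝒜 n) : P a := by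
  obtain ⟨a, rfl⟩ := RingQuot.mkAlgHom_surjective K (Rel 𝒜 n) a
  induction a using FreeAlgebra.induction with
  | grade0 c => rw [AlgHom.commutes]; exact halg c
  | grade1 t =>
    cases t with
    | p i y => exact hp i y
    | G i j => exact hG i j
  | mul a b ha hb => rw [map_mul]; exact hmul _ _ ha hb
  | add a b ha hb => rw [map_add]; exact hadd _ _ ha hb

end ModelRing

end Operations

namespace ModelRing

section Parity

variable {K : Type*} [Field K] {H : Type*} [Ring H] [Algebra K H] (𝒜 : ℕ → Submodule K H)
  [GradedAlgebra 𝒜]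

/-- The linear map on a graded space that is given by `f d` on the part of degree `d`. -/
noncomputable def gradedLift {W : Type*} [AddCommGroup W] [Module K W] (f : ℕ → H →ₗ[K] W) :
    H →ₗ[K] W :=
  DirectSum.toModule K ℕ W (fun d => (f d).comp (𝒜 d).subtype) ∘ₗ
    (DirectSum.decomposeLinearEquiv 𝒜).toLinearMap

lemma gradedLift_apply {W : Type*} [AddCommGroup W] [Module K W] (f : ℕ → H →ₗ[K] W)
    {d : ℕ} {y : H} (hy : y ∈ 𝒜 d) : gradedLift 𝒜 f y = f d y := by
  have h := DirectSum.decomposeLinearEquiv_apply_coe (R := K) 𝒜 d ⟨y, hy⟩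
  simp only at h
  simp [gradedLift, h]

lemma homogeneous_induction {P : H → Prop} (hadd : ∀ y z, P y → P z → P (y + z))
    (hom : ∀ d, ∀ y ∈ 𝒜 d, P y) (y : H) : P y :=
  DirectSum.Decomposition.inductionOn 𝒜 (hom 0 0 (zero_mem _)) (fun {d} m => hom d m m.2)
    (fun y z => hadd y z) y

/-- The parity involution `y ↦ (-1) ^ deg y * y` of a graded algebra. -/
noncomputable def sign : H →ₗ[K] H := gradedLift 𝒜 fun d => (-1 : K) ^ d • LinearMap.id

lemma sign_apply {d : ℕ} {y : H} (hy : y ∈ 𝒜 d) : sign 𝒜 y = (-1 : K) ^ d • y := by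
  simp [sign, gradedLift_apply 𝒜 _ hy]

lemma sign_mem {d : ℕ} {y : H} (hy : y ∈ 𝒜 d) : sign 𝒜 y ∈ 𝒜 d := by
  rw [sign_apply 𝒜 hy]; exact Submodule.smul_mem _ _ hy

lemma sign_one : sign 𝒜 (1 : H) = 1 := by
  simpa using sign_apply 𝒜 (SetLike.GradedOne.one_mem (A := 𝒜))

lemma sign_mul (y z : H) : sign 𝒜 (y * z) = sign 𝒜 y * sign 𝒜 z := by
  induction y using homogeneous_induction 𝒜 with
  | hadd y y' h h' => simp [add_mul, h, h']
  | hom d y hy =>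
    induction z using homogeneous_induction 𝒜 with
    | hadd z z' h h' => simp [mul_add, h, h']
    | hom e z hz =>
      rw [sign_apply 𝒜 hy, sign_apply 𝒜 hz, sign_apply 𝒜 (SetLike.GradedMul.mul_mem hy hz),
        smul_mul_smul_comm, pow_add]

lemma sign_sign (y : H) : sign 𝒜 (sign 𝒜 y) = y := by
  induction y using homogeneous_induction 𝒜 with
  | hadd y y' h h' => simp [h, h']
  | hom d y hy =>
    rw [sign_apply 𝒜 (sign_mem 𝒜 hy), sign_apply 𝒜 hy, smul_smul, ← mul_pow]
    simp

lemma neg_one_pow_smul {A : Type*} [Ring A] [Algebra K A] (d : ℕ) (a : A) :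
    (-1 : K) ^ d • a = (-1) ^ d * a := by
  rcases neg_one_pow_eq_or K d with h | h <;> rcases Nat.even_or_odd d with h' | h' <;>
    simp [h'.neg_one_pow]

variable {n : ℕ}

lemma p_sign {d : ℕ} {y : H} (hy : y ∈ 𝒜 d) (i : Fin n) :
    p 𝒜 i (sign 𝒜 y) = (-1) ^ d * p 𝒜 i y := by
  rw [sign_apply 𝒜 hy, p_smul, neg_one_pow_smul]

/-- The value on generators of the parity involution of the model. -/
noncomputable def parityGen : Gen H n → ModelRing 𝒜 n
  | .p i y => p 𝒜 i (sign 𝒜 y)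
  | .G i j => -G 𝒜 i j

lemma parityGen_rel ⦃a b : FreeAlgebra K (Gen H n)⦄ (h : Rel 𝒜 n a b) :
    FreeAlgebra.lift K (parityGen 𝒜) a = FreeAlgebra.lift K (parityGen 𝒜) b := by
  induction h with
  | p_add i x y => simpa [parityGen] using p_add 𝒜 _ _ _
  | p_smul i c x => simpa [parityGen] using p_smul 𝒜 _ c _
  | p_one i => simpa [parityGen, sign_one] using p_one 𝒜 _
  | p_mul i x y => simpa [parityGen, sign_mul] using p_mul 𝒜 _ _ _
  | p_comm i j hij a b x y hx hy =>
    simpa [parityGen] using p_comm 𝒜 hij (sign_mem 𝒜 hx) (sign_mem 𝒜 hy)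
  | G_diag i => simpa [parityGen] using G_diag 𝒜 _
  | G_symm i j => simpa [parityGen] using G_symm 𝒜 _ _
  | G_sq i j => simpa [parityGen] using G_sq 𝒜 _ _
  | G_anticomm i j k l => simpa [parityGen] using G_anticomm 𝒜 _ _ _ _
  | G_p_comm i j k a x hx => simpa [parityGen] using G_p_comm 𝒜 _ _ _ (sign_mem 𝒜 hx)
  | p_G i j hij x => simpa [parityGen] using p_G 𝒜 _ _ _
  | arnold i j k hij hjk => simpa [parityGen] using arnold 𝒜 i j k

/-- The parity involution of the model: `p_i^*(y) ↦ (-1) ^ deg y * p_i^*(y)`, `G_{ij} ↦ -G_{ij}`. -/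
noncomputable def parity : ModelRing 𝒜 n →ₐ[K] ModelRing 𝒜 n :=
  lift (parityGen 𝒜) (parityGen_rel 𝒜)

@[simp] lemma parity_p (i : Fin n) (y : H) : parity 𝒜 (p 𝒜 i y) = p 𝒜 i (sign 𝒜 y) :=
  lift_p 𝒜 _ (parityGen_rel 𝒜) i y

@[simp] lemma parity_G (i j : Fin n) : parity 𝒜 (G 𝒜 i j) = -G 𝒜 i j :=
  lift_G 𝒜 _ (parityGen_rel 𝒜) i j

@[simp] lemma parity_parity (a : ModelRing 𝒜 n) : parity 𝒜 (parity 𝒜 a) = a := by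
  induction a using ModelRing.induction 𝒜 with
  | halg c => simp
  | hadd a b ha hb => simp [ha, hb]
  | hmul a b ha hb => simp [ha, hb]
  | hp i y => simp [sign_sign]
  | hG i j => simp

/-- Every element of the model supercommutes with the odd element `G_{ij}`. -/
lemma mul_G (a : ModelRing 𝒜 n) (i j : Fin n) : a * G 𝒜 i j = G 𝒜 i j * parity 𝒜 a := by
  induction a using ModelRing.induction 𝒜 with
  | halg c => simp [Algebra.commutes]
  | hadd a b ha hb => simp [add_mul, mul_add, ha, hb]
  | hmul a b ha hb => rw [mul_assoc, hb, ← mul_assoc, ha, mul_assoc, map_mul]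
  | hp k y =>
    induction y using homogeneous_induction 𝒜 with
    | hadd y z hy hz => simp only [p_add, add_mul, hy, hz, map_add, mul_add]
    | hom d y hy =>
      rw [parity_p, G_p_comm 𝒜 k i j (sign_mem 𝒜 hy), p_sign 𝒜 hy, mul_assoc]
      rcases neg_one_pow_eq_or (ModelRing 𝒜 n) d with h | h <;> simp [h]
  | hG k l => simpa using G_anticomm 𝒜 _ _ _ _

variable {𝒜} in
/-- Every element of the model supercommutes with the homogeneous element `p_i^*(y)`. -/
lemma mul_p (hcomm : ∀ (a b : ℕ) (y z : H), y ∈ 𝒜 a → z ∈ 𝒜 b → y * z = (-1) ^ (a * b) * (z * y))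
    (a : ModelRing 𝒜 n) (i : Fin n) {d : ℕ} {y : H} (hy : y ∈ 𝒜 d) :
    a * p 𝒜 i y = p 𝒜 i y * (parity 𝒜 ^ d) a := by
  induction a using ModelRing.induction 𝒜 with
  | halg c => rw [AlgHom.commutes, Algebra.commutes]
  | hadd a b ha hb => simp [add_mul, mul_add, ha, hb]
  | hmul a b ha hb => rw [mul_assoc, hb, ← mul_assoc, ha, mul_assoc, map_mul]
  | hp k z =>
    have key : ∀ e, ∀ z ∈ 𝒜 e, p 𝒜 k z * p 𝒜 i y = (-1) ^ (d * e) * (p 𝒜 i y * p 𝒜 k z) := by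
      intro e z hz
      rcases eq_or_ne k i with rfl | hki
      · rw [← p_mul, ← p_mul, hcomm e d z y hz hy, mul_comm d, ← neg_one_pow_smul (K := K),
          ← neg_one_pow_smul (K := K), p_smul]
      · rw [p_comm 𝒜 hki hz hy, mul_comm d]
    induction z using homogeneous_induction 𝒜 with
    | hadd y z hy hz => simp only [p_add, add_mul, hy, hz, map_add, mul_add]
    | hom e z hz =>
      have h2 : (parity 𝒜 ^ d) (p 𝒜 k z) = (-1) ^ (d * e) * p 𝒜 k z := by
        clear hy key
        induction d with
        | zero => simp
        | succ d ih =>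
          rw [pow_succ', AlgHom.mul_apply, ih, map_mul, parity_p, p_sign 𝒜 hz]
          simp [← mul_assoc, ← pow_add, add_mul]
      rw [h2, key e z hz]
      rcases neg_one_pow_eq_or (ModelRing 𝒜 n) (d * e) with h | h <;> simp [h]
  | hG k l =>
    rw [G_p_comm 𝒜 _ _ _ hy]
    have h2 : (parity 𝒜 ^ d) (G 𝒜 k l) = (-1) ^ d * G 𝒜 k l := by
      clear hy
      induction d with
      | zero => simp
      | succ d ih =>
        rw [pow_succ', AlgHom.mul_apply, ih, map_mul, parity_G]
        simp [pow_succ]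
    rw [h2]
    rcases neg_one_pow_eq_or (ModelRing 𝒜 n) d with h | h <;> simp [h]

end Parity

end ModelRing

open scoped TensorProduct

/-! ### The model on one more point as a module -/

namespace ModelRing

section Extension

variable {K : Type*} [Field K] {H : Type*} [Ring H] [Algebra K H] (𝒜 : ℕ → Submodule K H)
  [GradedAlgebra 𝒜] (n : ℕ)

/-- The model on `n + 1` points as it looks over the model `A` on `n` points: the summand `A ⊗ H`
stands for the products `a * p_{n+1}^*(h)`, and the `i`-th of the remaining `n` summands `A` for the
products `a * G_{i,n+1}`. -/
abbrev Extension : Type _ := (ModelRing 𝒜 n ⊗[K] H) × (Fin n → ModelRing 𝒜 n)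

variable {n}

/-- The element standing for `a * p_{n+1}^*(h)`. -/
noncomputable def root (a : ModelRing 𝒜 n) (h : H) : Extension 𝒜 n := (a ⊗ₜ h, 0)

/-- The elements standing for `a * G_{i,n+1}`. -/
noncomputable def leaf (i : Fin n) : ModelRing 𝒜 n →ₗ[K] Extension 𝒜 n :=
  LinearMap.inr K _ _ ∘ₗ LinearMap.single K (fun _ => ModelRing 𝒜 n) i

omit [GradedAlgebra 𝒜] in
lemma extension_hom_ext {W : Type*} [AddCommGroup W] [Module K W] {f g : Extension 𝒜 n →ₗ[K] W}
    (hr : ∀ a h, f (root 𝒜 a h) = g (root 𝒜 a h)) (hl : ∀ i a, f (leaf 𝒜 i a) = g (leaf 𝒜 i a)) :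
    f = g := by
  refine LinearMap.prod_ext (TensorProduct.ext' hr) (LinearMap.pi_ext' fun i => ?_)
  ext a
  exact hl i a

/-- The operators on the two kinds of summands of the extension, put together. -/
noncomputable def extensionHom {W : Type*} [AddCommGroup W] [Module K W]
    (f : ModelRing 𝒜 n →ₗ[K] H →ₗ[K] W) (g : Fin n → ModelRing 𝒜 n →ₗ[K] W) :
    Extension 𝒜 n →ₗ[K] W :=
  LinearMap.coprod (TensorProduct.lift f) (LinearMap.lsum K (fun _ => ModelRing 𝒜 n) K g)

omit [GradedAlgebra 𝒜] in
@[simp] lemma extensionHom_root {W : Type*} [AddCommGroup W] [Module K W]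
    (f : ModelRing 𝒜 n →ₗ[K] H →ₗ[K] W) (g : Fin n → ModelRing 𝒜 n →ₗ[K] W) (a h) :
    extensionHom 𝒜 f g (root 𝒜 a h) = f a h := by
  simp [extensionHom, root]

omit [GradedAlgebra 𝒜] in
@[simp] lemma extensionHom_leaf {W : Type*} [AddCommGroup W] [Module K W]
    (f : ModelRing 𝒜 n →ₗ[K] H →ₗ[K] W) (g : Fin n → ModelRing 𝒜 n →ₗ[K] W) (i a) :
    extensionHom 𝒜 f g (leaf 𝒜 i a) = g i a := by
  have h : ∑ j, g j ((Pi.single i a : Fin n → ModelRing 𝒜 n) j) = g i a := by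
    rw [Finset.sum_eq_single i (by simp +contextual) (by simp)]
    simp
  simpa [extensionHom, leaf] using h

/-- The bilinear map `(a, h) ↦ a * p_{n+1}^*(h)`. -/
noncomputable def rootHom : ModelRing 𝒜 n →ₗ[K] H →ₗ[K] Extension 𝒜 n :=
  (TensorProduct.mk K _ _).compr₂ (LinearMap.inl K _ _)

omit [GradedAlgebra 𝒜] in
@[simp] lemma rootHom_apply (a : ModelRing 𝒜 n) (h : H) : rootHom 𝒜 a h = root 𝒜 a h := rfl

omit [GradedAlgebra 𝒜] in
lemma root_add_right (a : ModelRing 𝒜 n) (h h' : H) :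
    root 𝒜 a (h + h') = root 𝒜 a h + root 𝒜 a h' := by
  simp only [← rootHom_apply, map_add]

omit [GradedAlgebra 𝒜] in
lemma root_smul_left (c : K) (a : ModelRing 𝒜 n) (h : H) :
    root 𝒜 (c • a) h = c • root 𝒜 a h := by
  simp [← rootHom_apply]

/-- Left multiplication by the model on `n` points. -/
noncomputable def mulOld : ModelRing 𝒜 n →ₐ[K] Module.End K (Extension 𝒜 n) :=
  AlgHom.ofLinearMap
    { toFun b := extensionHom 𝒜 ((rootHom 𝒜).comp (LinearMap.mulLeft K b))
        fun i => (leaf 𝒜 i).comp (LinearMap.mulLeft K b)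
      map_add' b c := extension_hom_ext 𝒜 (by simp [add_mul])
        (by simp [add_mul])
      map_smul' c b := extension_hom_ext 𝒜 (by simp) (by simp) }
    (extension_hom_ext 𝒜 (by simp) (by simp))
    (fun b c => extension_hom_ext 𝒜 (by simp) (by simp))

omit [GradedAlgebra 𝒜] in
@[simp] lemma mulOld_root (b a : ModelRing 𝒜 n) (h : H) :
    mulOld 𝒜 b (root 𝒜 a h) = root 𝒜 (b * a) h := by
  simp [mulOld]

omit [GradedAlgebra 𝒜] in
@[simp] lemma mulOld_leaf (b a : ModelRing 𝒜 n) (i : Fin n) :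
    mulOld 𝒜 b (leaf 𝒜 i a) = leaf 𝒜 i (b * a) := by
  simp [mulOld]

/-- Left multiplication by `p_{n+1}^*(y)`, for `y` homogeneous of degree `d`. On the products
`a * G_{i,n+1}` it is left multiplication by `p_i^*(y)`. -/
noncomputable def mulLastPHom (d : ℕ) : H →ₗ[K] Module.End K (Extension 𝒜 n) where
  toFun y := extensionHom 𝒜
    ((LinearMap.lcomp K _ (LinearMap.mulLeft K y) ∘ₗ rootHom 𝒜) ∘ₗ (parity 𝒜 ^ d).toLinearMap)
    fun i => (leaf 𝒜 i).comp (LinearMap.mulLeft K (p 𝒜 i y))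
  map_add' y z := extension_hom_ext 𝒜 (by simp [root_add_right, add_mul])
    (by simp [p_add, add_mul])
  map_smul' c y := extension_hom_ext 𝒜 (by simp)
    (by simp [p_smul])

/-- Left multiplication by `p_{n+1}^*(y)`. -/
noncomputable def mulLastP : H →ₗ[K] Module.End K (Extension 𝒜 n) :=
  gradedLift 𝒜 (mulLastPHom 𝒜)

lemma mulLastP_root {d : ℕ} {y : H} (hy : y ∈ 𝒜 d) (a : ModelRing 𝒜 n) (h : H) :
    mulLastP 𝒜 y (root 𝒜 a h) = root 𝒜 ((parity 𝒜 ^ d) a) (y * h) := by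
  simp [mulLastP, gradedLift_apply 𝒜 _ hy, mulLastPHom]

@[simp] lemma mulLastP_leaf (y : H) (i : Fin n) (a : ModelRing 𝒜 n) :
    mulLastP 𝒜 y (leaf 𝒜 i a) = leaf 𝒜 i (p 𝒜 i y * a) := by
  induction y using homogeneous_induction 𝒜 with
  | hadd y z hy hz => simp [hy, hz, p_add, add_mul]
  | hom d y hy => simp [mulLastP, gradedLift_apply 𝒜 _ hy, mulLastPHom]

/-- Left multiplication by `G_{i,n+1}`. Supercommutativity and the relations of the model give
`G_{i,n+1} * (a * p_{n+1}^*(h)) = parity (a * p_i^*(h)) * G_{i,n+1}` and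
`G_{i,n+1} * (a * G_{j,n+1}) = G_{ij} * a * G_{j,n+1} - G_{ij} * a * G_{i,n+1}`. -/
noncomputable def mulLastG (i : Fin n) : Module.End K (Extension 𝒜 n) :=
  extensionHom 𝒜
    (LinearMap.mk₂ K (fun a h => leaf 𝒜 i (parity 𝒜 (a * p 𝒜 i h)))
      (by simp [add_mul]) (by simp) (by simp [p_add, mul_add]) (by simp [p_smul]))
    fun j => (leaf 𝒜 j - leaf 𝒜 i).comp (LinearMap.mulLeft K (G 𝒜 i j))

@[simp] lemma mulLastG_root (i : Fin n) (a : ModelRing 𝒜 n) (h : H) :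
    mulLastG 𝒜 i (root 𝒜 a h) = leaf 𝒜 i (parity 𝒜 (a * p 𝒜 i h)) := by
  simp [mulLastG]

@[simp] lemma mulLastG_leaf (i j : Fin n) (a : ModelRing 𝒜 n) :
    mulLastG 𝒜 i (leaf 𝒜 j a) = leaf 𝒜 j (G 𝒜 i j * a) - leaf 𝒜 i (G 𝒜 i j * a) := by
  simp [mulLastG]

lemma mulLastP_one : mulLastP 𝒜 (n := n) 1 = 1 :=
  extension_hom_ext 𝒜
    (fun a h => by simp [mulLastP_root 𝒜 (SetLike.GradedOne.one_mem (A := 𝒜))])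
    (by simp [p_one])

lemma mulLastP_mul (y z : H) : mulLastP 𝒜 (n := n) (y * z) = mulLastP 𝒜 y * mulLastP 𝒜 z := by
  induction y using homogeneous_induction 𝒜 with
  | hadd y y' h h' => simp [add_mul, h, h']
  | hom d y hy =>
    induction z using homogeneous_induction 𝒜 with
    | hadd z z' h h' => simp [mul_add, h, h']
    | hom e z hz =>
      refine extension_hom_ext 𝒜 (fun a h => ?_) (by simp [p_mul, mul_assoc])
      rw [Module.End.mul_apply, mulLastP_root 𝒜 hz, mulLastP_root 𝒜 hy,
        mulLastP_root 𝒜 (SetLike.GradedMul.mul_mem hy hz), pow_add, AlgHom.mul_apply, mul_assoc]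

lemma parity_pow_p {d e : ℕ} {y : H} (hy : y ∈ 𝒜 d) (i : Fin n) :
    (parity 𝒜 ^ e) (p 𝒜 i y) = (-1 : K) ^ (d * e) • p 𝒜 i y := by
  induction e with
  | zero => simp
  | succ e ih =>
    rw [pow_succ', AlgHom.mul_apply, ih, map_smul, parity_p, sign_apply 𝒜 hy, p_smul, smul_smul,
      ← pow_add, mul_add_one]

lemma parity_pow_G (e : ℕ) (i j : Fin n) :
    (parity 𝒜 ^ e) (G 𝒜 i j) = (-1 : K) ^ e • G 𝒜 i j := by
  induction e with
  | zero => simp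
  | succ e ih => rw [pow_succ', AlgHom.mul_apply, ih, map_smul, parity_G, pow_succ]; simp

lemma parity_pow_parity (e : ℕ) (a : ModelRing 𝒜 n) :
    (parity 𝒜 ^ e) (parity 𝒜 a) = parity 𝒜 ((parity 𝒜 ^ e) a) := by
  rw [← AlgHom.mul_apply, ← AlgHom.mul_apply, ← pow_succ, ← pow_succ']

lemma parity_pow_pow (e : ℕ) (a : ModelRing 𝒜 n) : (parity 𝒜 ^ e) ((parity 𝒜 ^ e) a) = a := by
  induction e generalizing a with
  | zero => simp
  | succ e ih =>
    rw [pow_succ, AlgHom.mul_apply, AlgHom.mul_apply, parity_pow_parity, ih, parity_parity]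

variable {𝒜} in
lemma mulLastP_mul_mulOld
    (hcomm : ∀ (a b : ℕ) (y z : H), y ∈ 𝒜 a → z ∈ 𝒜 b → y * z = (-1) ^ (a * b) * (z * y))
    {d : ℕ} {y : H} (hy : y ∈ 𝒜 d) (b : ModelRing 𝒜 n) :
    mulLastP 𝒜 y * mulOld 𝒜 b = mulOld 𝒜 ((parity 𝒜 ^ d) b) * mulLastP 𝒜 y := by
  refine extension_hom_ext 𝒜 (fun a h => ?_) (fun i a => ?_)
  · simp [mulLastP_root 𝒜 hy]
  · simp only [Module.End.mul_apply, mulLastP_leaf, mulOld_leaf, ← mul_assoc,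
      mul_p hcomm ((parity 𝒜 ^ d) b) i hy, parity_pow_pow]

lemma mulLastG_mul_mulOld (i : Fin n) (b : ModelRing 𝒜 n) :
    mulLastG 𝒜 i * mulOld 𝒜 b = mulOld 𝒜 (parity 𝒜 b) * mulLastG 𝒜 i := by
  refine extension_hom_ext 𝒜 (fun a h => ?_) (fun i a => ?_)
  · simp [mul_assoc]
  · simp [← mul_assoc, mul_G 𝒜 (parity 𝒜 b)]

variable {𝒜} in
lemma mulLastG_mul_mulLastP
    (hcomm : ∀ (a b : ℕ) (y z : H), y ∈ 𝒜 a → z ∈ 𝒜 b → y * z = (-1) ^ (a * b) * (z * y))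
    {d : ℕ} {y : H} (hy : y ∈ 𝒜 d) (i : Fin n) :
    mulLastG 𝒜 i * mulLastP 𝒜 y = (-1 : K) ^ d • (mulLastP 𝒜 y * mulLastG 𝒜 i) := by
  have hG (j : Fin n) (a : ModelRing 𝒜 n) :
      G 𝒜 i j * (p 𝒜 j y * a) = (-1 : K) ^ d • (p 𝒜 j y * (G 𝒜 i j * a)) := by
    rw [← mul_assoc, G_p_comm 𝒜 _ _ _ hy, ← neg_one_pow_smul (K := K), smul_mul_assoc, mul_assoc]
  have hG' (j : Fin n) (a : ModelRing 𝒜 n) :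
      G 𝒜 i j * (p 𝒜 j y * a) = (-1 : K) ^ d • (p 𝒜 i y * (G 𝒜 i j * a)) := by
    rw [hG, ← mul_assoc, p_G, mul_assoc]
  refine extension_hom_ext 𝒜 (fun a h => ?_) (fun j a => ?_)
  · simp only [Module.End.mul_apply, mulLastP_root 𝒜 hy, mulLastG_root, LinearMap.smul_apply,
      mulLastP_leaf, p_mul, map_mul, parity_p 𝒜 i y, sign_apply 𝒜 hy, p_smul, ← map_smul]
    rw [← mul_assoc, mul_smul_comm, mul_p hcomm _ i hy, parity_pow_parity, parity_pow_pow,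
      smul_mul_assoc, mul_assoc]
  · simp only [Module.End.mul_apply, mulLastP_leaf, mulLastG_leaf, LinearMap.smul_apply, map_sub,
      smul_sub, ← map_smul]
    rw [← hG, ← hG']

lemma G_mul_parity (i j : Fin n) (a : ModelRing 𝒜 n) (h : H) :
    G 𝒜 i j * parity 𝒜 (a * p 𝒜 j h) = G 𝒜 i j * parity 𝒜 (a * p 𝒜 i h) := by
  rw [← mul_G, ← mul_G, mul_assoc, mul_assoc, p_G]

/-- On the products `a * G_{k,n+1}` this is the relation of Arnold for `i`, `j`, `k`. -/
lemma mulLastG_anticomm (i j : Fin n) :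
    mulLastG 𝒜 i * mulLastG 𝒜 j = -(mulLastG 𝒜 j * mulLastG 𝒜 i) := by
  refine extension_hom_ext 𝒜 (fun a h => ?_) (fun k a => ?_)
  · simp [-map_mul, G_symm 𝒜 i j, G_mul_parity 𝒜 i j]
  · have h1 := G_anticomm 𝒜 i k j k
    have h2 := arnold 𝒜 i j k
    have h3 := G_anticomm 𝒜 i j j k
    have h4 := G_anticomm 𝒜 i k i j
    have key : G 𝒜 j k * (G 𝒜 i k * a) =
      G 𝒜 i j * (G 𝒜 i k * a) - G 𝒜 i j * (G 𝒜 j k * a) := by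
      simp only [← mul_assoc, ← sub_mul]
      rw [← neg_inj, ← neg_mul, ← h1, h2, ← neg_mul]; congr 1; abel
    have key2 : G 𝒜 i k * (G 𝒜 j k * a) =
      G 𝒜 i j * (G 𝒜 j k * a) - G 𝒜 i j * (G 𝒜 i k * a) := by
      simp only [← mul_assoc, ← sub_mul, h2]
    have key3 : G 𝒜 j k * (G 𝒜 i j * a) = - (G 𝒜 i j * (G 𝒜 j k * a)) := by
      simp only [← mul_assoc, ← neg_mul, h3, neg_neg]
    have key4 : G 𝒜 i k * (G 𝒜 i j * a) = - (G 𝒜 i j * (G 𝒜 i k * a)) := by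
      simp only [← mul_assoc, ← neg_mul, h4]
    simp only [Module.End.mul_apply, mulLastG_leaf, map_sub, LinearMap.neg_apply, G_symm 𝒜 i j,
      key, key2]
    abel

lemma mulLastG_arnold (i j : Fin n) :
    mulLastG 𝒜 i * mulLastG 𝒜 j =
      mulOld 𝒜 (G 𝒜 i j) * mulLastG 𝒜 j - mulOld 𝒜 (G 𝒜 i j) * mulLastG 𝒜 i := by
  refine extension_hom_ext 𝒜 (fun a h => ?_) (fun k a => ?_)
  · simp [-map_mul, G_mul_parity 𝒜 i j]
  · have h1 := G_anticomm 𝒜 i k j k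
    have h2 := arnold 𝒜 i j k
    have key2 : G 𝒜 i k * (G 𝒜 j k * a) =
      G 𝒜 i j * (G 𝒜 j k * a) - G 𝒜 i j * (G 𝒜 i k * a) := by
      simp only [← mul_assoc, ← sub_mul, h2]
    simp only [Module.End.mul_apply, mulLastG_leaf, map_sub, LinearMap.sub_apply, mulOld_leaf,
      key2]
    abel

/-- The operators by which the generators of the model on `n + 1` points act on the extension. -/
noncomputable def extensionGen : Gen H (n + 1) → Module.End K (Extension 𝒜 n)
  | .p i y => Fin.lastCases (mulLastP 𝒜 y) (fun i => mulOld 𝒜 (p 𝒜 i y)) i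
  | .G i j => Fin.lastCases (Fin.lastCases 0 (fun j => mulLastG 𝒜 j) j)
      (fun i => Fin.lastCases (mulLastG 𝒜 i) (fun j => mulOld 𝒜 (G 𝒜 i j)) j) i

variable {𝒜} in
/-- The operators satisfy the relations of the model on `n + 1` points. A relation which involves
the last point reduces to the relations of the operators `mulLastP` and `mulLastG`, any other one
to the same relation in the model on `n` points. -/
lemma extensionGen_rel
    (hcomm : ∀ (a b : ℕ) (y z : H), y ∈ 𝒜 a → z ∈ 𝒜 b → y * z = (-1) ^ (a * b) * (z * y))
    ⦃a b : FreeAlgebra K (Gen H (n + 1))⦄ (h : Rel 𝒜 (n + 1) a b) :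
    FreeAlgebra.lift K (extensionGen 𝒜) a = FreeAlgebra.lift K (extensionGen 𝒜) b := by
  induction h with
  | p_add i x y =>
    cases i using Fin.lastCases <;> simp [extensionGen, p_add]
  | p_smul i c x =>
    cases i using Fin.lastCases <;> simp [extensionGen, p_smul]
  | p_one i =>
    cases i using Fin.lastCases <;> simp [extensionGen, p_one, mulLastP_one]
  | p_mul i x y =>
    cases i using Fin.lastCases <;> simp [extensionGen, p_mul, mulLastP_mul]
  | p_comm i j hij a b x y hx hy =>
    cases i using Fin.lastCases with
    | last =>
      cases j using Fin.lastCases with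
      | last => exact absurd rfl hij
      | cast j =>
        simp only [map_mul, FreeAlgebra.lift_ι_apply, extensionGen,
          Fin.lastCases_last, Fin.lastCases_castSucc, mulLastP_mul_mulOld hcomm hx,
          parity_pow_p 𝒜 hy, map_smul, smul_mul_assoc, ← neg_one_pow_smul (K := K), mul_comm]
    | cast i =>
      cases j using Fin.lastCases with
      | last =>
        simp only [map_mul, FreeAlgebra.lift_ι_apply, extensionGen,
          Fin.lastCases_last, Fin.lastCases_castSucc, mulLastP_mul_mulOld hcomm hy,
          parity_pow_p 𝒜 hx, map_smul, smul_mul_assoc, ← neg_one_pow_smul (K := K), smul_smul]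
        rcases neg_one_pow_eq_or K (a * b) with h | h <;> simp [h]
      | cast j =>
        have := congrArg (mulOld 𝒜) (p_comm 𝒜 (i := i) (j := j) (by simpa using hij) hx hy)
        simpa [extensionGen] using this
  | G_diag i =>
    cases i using Fin.lastCases <;> simp [extensionGen, G_diag]
  | G_symm i j =>
    cases i using Fin.lastCases <;> cases j using Fin.lastCases <;> simp [extensionGen, G_symm]
  | G_sq i j =>
    have hl (i : Fin n) : mulLastG 𝒜 i * mulLastG 𝒜 i = 0 := by
      rw [mulLastG_arnold, G_diag]; simp
    have ho (i j : Fin n) : mulOld 𝒜 (G 𝒜 i j) * mulOld 𝒜 (G 𝒜 i j) = 0 := by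
      rw [← map_mul, G_sq, map_zero]
    cases i using Fin.lastCases <;> cases j using Fin.lastCases <;> simp [extensionGen, hl, ho]
  | G_anticomm i j k l =>
    have hlo (i j k : Fin n) : mulLastG 𝒜 k * mulOld 𝒜 (G 𝒜 i j) =
        -(mulOld 𝒜 (G 𝒜 i j) * mulLastG 𝒜 k) := by
      rw [mulLastG_mul_mulOld, parity_G, map_neg]
      exact neg_mul (mulOld 𝒜 (G 𝒜 i j)) (mulLastG 𝒜 k)
    have hol (i j k : Fin n) : mulOld 𝒜 (G 𝒜 i j) * mulLastG 𝒜 k =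
        -(mulLastG 𝒜 k * mulOld 𝒜 (G 𝒜 i j)) := by
      rw [hlo, neg_neg]
    have hoo (i j k l : Fin n) : mulOld 𝒜 (G 𝒜 i j) * mulOld 𝒜 (G 𝒜 k l) =
        -(mulOld 𝒜 (G 𝒜 k l) * mulOld 𝒜 (G 𝒜 i j)) := by
      rw [← map_mul, G_anticomm, map_neg, map_mul]
    have hll (i j : Fin n) := mulLastG_anticomm 𝒜 i j
    simp only [map_mul, map_neg, FreeAlgebra.lift_ι_apply, extensionGen]
    cases i using Fin.lastCases <;> cases j using Fin.lastCases <;>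
      cases k using Fin.lastCases <;> cases l using Fin.lastCases <;>
      simp only [Fin.lastCases_last, Fin.lastCases_castSucc, zero_mul, mul_zero, neg_zero] <;>
      first
        | with_reducible exact hll _ _ | with_reducible exact hol _ _ _
        | with_reducible exact hlo _ _ _ | with_reducible exact hoo _ _ _ _
  | G_p_comm i j k a x hx =>
    have hol (i j : Fin n) : mulOld 𝒜 (G 𝒜 i j) * mulLastP 𝒜 x =
        (-1 : K) ^ a • (mulLastP 𝒜 x * mulOld 𝒜 (G 𝒜 i j)) := by
      rw [mulLastP_mul_mulOld hcomm hx, parity_pow_G, map_smul, smul_mul_assoc, smul_smul]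
      rcases neg_one_pow_eq_or K a with h | h <;> simp [h]
    have hlo (i j : Fin n) : mulLastG 𝒜 i * mulOld 𝒜 (p 𝒜 j x) =
        (-1 : K) ^ a • (mulOld 𝒜 (p 𝒜 j x) * mulLastG 𝒜 i) := by
      rw [mulLastG_mul_mulOld, parity_p, sign_apply 𝒜 hx, p_smul, map_smul, smul_mul_assoc]
    have hoo (i j k : Fin n) : mulOld 𝒜 (G 𝒜 i j) * mulOld 𝒜 (p 𝒜 k x) =
        (-1 : K) ^ a • (mulOld 𝒜 (p 𝒜 k x) * mulOld 𝒜 (G 𝒜 i j)) := by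
      rw [← map_mul, G_p_comm 𝒜 _ _ _ hx, ← neg_one_pow_smul (K := K), map_smul, map_mul]
    have hll (i : Fin n) := mulLastG_mul_mulLastP hcomm hx i
    simp only [map_mul, map_smul, FreeAlgebra.lift_ι_apply, extensionGen,
      ← neg_one_pow_smul (K := K)]
    cases i using Fin.lastCases <;> cases j using Fin.lastCases <;>
      cases k using Fin.lastCases <;>
      simp only [Fin.lastCases_last, Fin.lastCases_castSucc, zero_mul, mul_zero, smul_zero] <;>
      first
        | with_reducible exact hll _ | with_reducible exact hol _ _
        | with_reducible exact hlo _ _ | with_reducible exact hoo _ _ _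
  | p_G i j hij x =>
    cases i using Fin.lastCases with
    | last => exact absurd hij (Fin.le_last _).not_gt
    | cast i =>
      simp only [map_mul, FreeAlgebra.lift_ι_apply, extensionGen]
      cases j using Fin.lastCases with
      | last =>
        simp only [Fin.lastCases_last, Fin.lastCases_castSucc]
        refine extension_hom_ext 𝒜 (fun a h => by simp) (fun k a => ?_)
        have := p_G 𝒜 i k x
        simp [← mul_assoc, this]
      | cast j => simp only [Fin.lastCases_castSucc, ← map_mul, p_G]
  | arnold i j k hij hjk =>
    cases j using Fin.lastCases with
    | last => exact absurd hjk (Fin.le_last _).not_gt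
    | cast j =>
      cases i using Fin.lastCases with
      | last => exact absurd hij (Fin.le_last _).not_gt
      | cast i =>
        simp only [map_mul, map_sub, FreeAlgebra.lift_ι_apply, extensionGen]
        cases k using Fin.lastCases with
        | last => simpa only [Fin.lastCases_last, Fin.lastCases_castSucc] using
            mulLastG_arnold 𝒜 i j
        | cast k => simp only [Fin.lastCases_castSucc, ← map_mul, ← map_sub, arnold 𝒜 i j k]

end Extension

end ModelRing

open scoped TensorProduct

/-! ### Linear independence of the canonical monomials -/

namespace MarkedForest

variable {n : ℕ} {ι : Type*}

/-- The index `i` seen as one of the first `n` indices, if it is not the last. -/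
def dropLast (o : Option (Fin (n + 1))) : Option (Fin n) :=
  o.bind fun i => if h : (i : ℕ) < n then some (i.castLT h) else none

lemma map_castSucc_dropLast (F : MarkedForest (n + 1) ι) (j : Fin (n + 1)) :
    (dropLast (F.parent j)).map Fin.castSucc = F.parent j := by
  cases h : F.parent j with
  | none => simp [dropLast]
  | some i =>
    have := F.parent_lt i j h
    have h' : (i : ℕ) < n := by omega
    simp [dropLast, h']

/-- The restriction of a marked forest to all the vertices but the last. -/
def restrict (F : MarkedForest (n + 1) ι) : MarkedForest n ι where
  parent j := dropLast (F.parent j.castSucc)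
  parent_lt i j h := by
    have := F.map_castSucc_dropLast j.castSucc
    rw [h] at this
    simpa using F.parent_lt _ _ this.symm
  mark j := F.mark j.castSucc
  mark_parent i j h := by
    have := F.map_castSucc_dropLast j.castSucc
    rw [h] at this
    exact F.mark_parent _ _ this.symm

lemma parent_castSucc (F : MarkedForest (n + 1) ι) (j : Fin n) :
    F.parent j.castSucc = (F.restrict.parent j).map Fin.castSucc :=
  (F.map_castSucc_dropLast _).symm

/-- A forest on `n + 1` vertices, given by its restriction to the first `n` vertices and the mark
or the parent of the last vertex. -/
def code (F : MarkedForest (n + 1) ι) : (MarkedForest n ι × ι) ⊕ (Σ _ : Fin n, MarkedForest n ι) :=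
  match dropLast (F.parent (Fin.last n)) with
  | none => .inl (F.restrict, F.mark (Fin.last n))
  | some i => .inr ⟨i, F.restrict⟩

/-- The mark of the last vertex need not be recorded when it has a parent. -/
lemma code_injective : Function.Injective (code : MarkedForest (n + 1) ι → _) := by
  intro F F' h
  have hF := F.map_castSucc_dropLast (Fin.last n)
  have hF' := F'.map_castSucc_dropLast (Fin.last n)
  unfold code at h
  have key (hr : F.restrict = F'.restrict) (hp : F.parent (Fin.last n) = F'.parent (Fin.last n))
      (hm : F.mark (Fin.last n) = F'.mark (Fin.last n)) : F = F' := by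
    ext1
    · funext j
      cases j using Fin.lastCases with
      | last => exact hp
      | cast j => rw [parent_castSucc, parent_castSucc, hr]
    · funext j
      cases j using Fin.lastCases with
      | last => exact hm
      | cast j => exact congrFun (congrArg mark hr) j
  cases hd : dropLast (F.parent (Fin.last n)) with
  | none =>
    cases hd' : dropLast (F'.parent (Fin.last n)) with
    | none =>
      simp only [hd, hd', Sum.inl.injEq, Prod.mk.injEq] at h
      exact key h.1 (by rw [← hF, ← hF', hd, hd']) h.2
    | some i => simp [hd, hd'] at h
  | some i =>
    cases hd' : dropLast (F'.parent (Fin.last n)) with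
    | none => simp [hd, hd'] at h
    | some i' =>
      simp only [hd, hd', Sum.inr.injEq, Sigma.mk.injEq, heq_eq_eq] at h
      refine key h.2 (by rw [← hF, ← hF', hd, hd', h.1]) ?_
      rw [hd] at hF
      rw [hd', ← h.1] at hF'
      rw [F.mark_parent _ _ hF.symm, F'.mark_parent _ _ hF'.symm]
      exact congrFun (congrArg mark h.2) i

end MarkedForest

namespace ModelRing

section Independence

variable {K : Type*} [Field K] {H : Type*} [Ring H] [Algebra K H] (𝒜 : ℕ → Submodule K H)
  {n : ℕ} {ι : Type*}

/-- The canonical monomial of a marked forest, as an element of `ModelRing 𝒜 n`. -/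
noncomputable def monomial (x : ι → H) (F : MarkedForest n ι) : ModelRing 𝒜 n :=
  (List.ofFn fun v => if F.parent v = none then p 𝒜 v (x (F.mark v)) else 1).prod *
    (List.ofFn fun j => (F.parent j).elim 1 fun i => G 𝒜 i j).prod

lemma coe_monomial (x : ι → H) (F : MarkedForest n ι) : Kriz.monomial 𝒜 x F = monomial 𝒜 x F := by
  have h : ∀ j, (F.parent j).elim 1 (fun i => Kriz.G 𝒜 i j) =
      match F.parent j with | none => 1 | some i => Kriz.G 𝒜 i j := by
    intro j
    cases F.parent j <;> rfl
  exact congrArg (fun f : Fin n → Model 𝒜 n =>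
    (List.ofFn fun v => if F.parent v = none then Kriz.p 𝒜 v (x (F.mark v)) else 1).prod *
      (List.ofFn f).prod) (funext h).symm

lemma exists_unit_smul_list_prod {A : Type*} [Ring A] [Algebra K A] (f : A →ₐ[K] A)
    (l : List A) (h : ∀ a ∈ l, ∃ u : Kˣ, f a = u • a) : ∃ u : Kˣ, f l.prod = u • l.prod := by
  induction l with
  | nil => exact ⟨1, by simp⟩
  | cons a l ih =>
    obtain ⟨u, hu⟩ := h a (by simp)
    obtain ⟨v, hv⟩ := ih fun b hb => h b (by simp [hb])
    exact ⟨u * v, by simp [hu, hv, smul_mul_smul_comm]⟩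

variable [GradedAlgebra 𝒜] {𝒜}
  (hcomm : ∀ (a b : ℕ) (y z : H), y ∈ 𝒜 a → z ∈ 𝒜 b → y * z = (-1) ^ (a * b) * (z * y))

/-- The action of the model on `n + 1` points on the extension of the model on `n` points. -/
noncomputable def extensionAction : ModelRing 𝒜 (n + 1) →ₐ[K] Module.End K (Extension 𝒜 n) :=
  lift (extensionGen 𝒜) (extensionGen_rel hcomm)

/-- The vectors of the extension to which the canonical monomials send `1`, up to sign. -/
noncomputable def codeVector (x : ι → H) :
    (MarkedForest n ι × ι) ⊕ (Σ _ : Fin n, MarkedForest n ι) → Extension 𝒜 n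
  | .inl (F, h) => root 𝒜 (monomial 𝒜 x F) (x h)
  | .inr ⟨i, F⟩ => leaf 𝒜 i (monomial 𝒜 x F)

/-- A canonical monomial on `n + 1` points acts on `1` as the monomial of its restriction followed
by the factor of the last vertex. The unit `u` is the sign that arises when the class at the last
vertex is moved past the `G_{ij}`. -/
lemma extensionAction_monomial {x : ι → H} {deg : ι → ℕ} (hdeg : ∀ h, x h ∈ 𝒜 (deg h))
    (F : MarkedForest (n + 1) ι) :
    ∃ u : Kˣ, extensionAction hcomm (monomial 𝒜 x F) (root 𝒜 1 1) = u • codeVector x F.code := by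
  have hpc (i : Fin n) (y : H) :
      extensionAction hcomm (p 𝒜 i.castSucc y) = mulOld 𝒜 (p 𝒜 i y) := by
    simp [extensionAction, lift_p, extensionGen]
  have hpl (y : H) : extensionAction hcomm (p 𝒜 (Fin.last n) y) = mulLastP 𝒜 y := by
    simp [extensionAction, lift_p, extensionGen]
  have hGc (i j : Fin n) :
      extensionAction hcomm (G 𝒜 i.castSucc j.castSucc) = mulOld 𝒜 (G 𝒜 i j) := by
    simp [extensionAction, lift_G, extensionGen]
  have hGl (i : Fin n) :
      extensionAction hcomm (G 𝒜 i.castSucc (Fin.last n)) = mulLastG 𝒜 i := by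
    simp [extensionAction, lift_G, extensionGen]
  set P : ModelRing 𝒜 n := (List.ofFn fun v => if F.restrict.parent v = none then
    p 𝒜 v (x (F.restrict.mark v)) else 1).prod with hP
  set Q : ModelRing 𝒜 n :=
    (List.ofFn fun j => (F.restrict.parent j).elim 1 fun i => G 𝒜 i j).prod with hQ
  have h1 : extensionAction hcomm ((List.ofFn fun v : Fin n => if F.parent v.castSucc = none then
      p 𝒜 v.castSucc (x (F.mark v.castSucc)) else 1).prod) = mulOld 𝒜 P := by
    rw [hP, map_list_prod, map_list_prod, List.map_ofFn, List.map_ofFn]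
    congr 2
    funext v
    simp only [Function.comp_apply, F.parent_castSucc, Option.map_eq_none_iff]
    split_ifs
    · exact hpc _ _
    · simp
  have h2 : extensionAction hcomm ((List.ofFn fun j : Fin n =>
      (F.parent j.castSucc).elim 1 fun i => G 𝒜 i j.castSucc).prod) = mulOld 𝒜 Q := by
    rw [hQ, map_list_prod, map_list_prod, List.map_ofFn, List.map_ofFn]
    congr 2
    funext v
    simp only [Function.comp_apply, F.parent_castSucc]
    cases F.restrict.parent v with
    | none => simp
    | some i => exact hGc _ _
  have hM : monomial 𝒜 x F.restrict = P * Q := rfl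
  rw [monomial, List.ofFn_succ', List.ofFn_succ', List.concat_eq_append, List.concat_eq_append,
    List.prod_append, List.prod_append, List.prod_singleton, List.prod_singleton, map_mul, map_mul,
    map_mul, h1, h2]
  have hl := F.map_castSucc_dropLast (Fin.last n)
  unfold MarkedForest.code
  cases hd : MarkedForest.dropLast (F.parent (Fin.last n)) with
  | none =>
    rw [hd] at hl
    obtain ⟨u, hu⟩ := exists_unit_smul_list_prod (K := K) (parity 𝒜 ^ deg (F.mark (Fin.last n)))
      (List.ofFn fun j => (F.restrict.parent j).elim 1 fun i => G 𝒜 i j) (by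
      intro a ha
      obtain ⟨j, rfl⟩ := List.mem_ofFn.1 ha
      cases F.restrict.parent j with
      | none => exact ⟨1, by simp⟩
      | some i => exact ⟨(-1) ^ deg (F.mark (Fin.last n)), by
          simp only [Option.elim_some, parity_pow_G]; simp [Units.smul_def]⟩)
    refine ⟨u, ?_⟩
    rw [← hQ] at hu
    simp only [← hl, Option.map_none, if_true, Option.elim_none, hpl, map_one, mul_one,
      Module.End.mul_apply, mulOld_root, mulLastP_root 𝒜 (hdeg _), hu, codeVector, hM]
    simp only [Units.smul_def, mul_smul_comm, root_smul_left]
  | some i =>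
    rw [hd] at hl
    refine ⟨1, ?_⟩
    simp only [← hl, Option.map_some, Option.elim_some, reduceCtorEq, if_false, map_one, mul_one,
      hGl, Module.End.mul_apply, mulLastG_root, mulOld_leaf, p_one, codeVector, hM, one_smul]

omit [GradedAlgebra 𝒜] in
lemma linearIndependent_codeVector {x : ι → H} (hx : LinearIndependent K x)
    (h : LinearIndependent K (monomial 𝒜 x : MarkedForest n ι → ModelRing 𝒜 n)) :
    LinearIndependent K (codeVector (𝒜 := 𝒜) (n := n) x) := by
  have h1 := LinearIndependent.tmul_of_flat_left h hx
  have h2 := Pi.linearIndependent_single (R := K) (fun (_ : Fin n) => monomial 𝒜 x) fun _ => h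
  have h3 : codeVector (𝒜 := 𝒜) (n := n) x = Sum.elim
      (LinearMap.inl K _ _ ∘ fun i : MarkedForest n ι × ι => monomial 𝒜 x i.1 ⊗ₜ[K] x i.2)
      (LinearMap.inr K (ModelRing 𝒜 n ⊗[K] H) _ ∘
        fun ji : Σ _ : Fin n, MarkedForest n ι => Pi.single ji.1 (monomial 𝒜 x ji.2)) := by
    funext s
    rcases s with ⟨F, y⟩ | ⟨i, F⟩ <;> rfl
  rw [h3]
  exact linearIndependent_inl_union_inr' h1 h2

include hcomm in
/-- By induction on `n`: applied to `1` in the extension, the canonical monomials on `n + 1` points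
become, up to sign, distinct members of a linearly independent family which is made from the
monomials on `n` points. -/
theorem linearIndependent_monomial {x : ι → H} (hx : LinearIndependent K x) {deg : ι → ℕ}
    (hdeg : ∀ h, x h ∈ 𝒜 (deg h)) :
    LinearIndependent K (monomial 𝒜 x : MarkedForest n ι → ModelRing 𝒜 n) := by
  induction n with
  | zero =>
    have : Subsingleton (MarkedForest 0 ι) :=
      ⟨fun F F' => by ext1 <;> funext i <;> exact i.elim0⟩
    have hnt : Nontrivial (ModelRing 𝒜 0) := by
      let f : ModelRing 𝒜 0 →ₐ[K] K := lift (fun _ => 0) (by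
        intro a b h
        cases h <;> exact Fin.elim0 ‹_›)
      exact f.toRingHom.domain_nontrivial
    refine LinearIndependent.of_subsingleton
      (i := ⟨fun i => i.elim0, fun i => i.elim0, fun i => i.elim0, fun i => i.elim0⟩) ?_
    simp [monomial]
  | succ n ih =>
    choose u hu using fun F => extensionAction_monomial (n := n) hcomm hdeg F
    let e : ModelRing 𝒜 (n + 1) →ₗ[K] Extension 𝒜 n :=
      (LinearMap.applyₗ (root 𝒜 1 1)).comp (extensionAction hcomm).toLinearMap
    refine LinearIndependent.of_comp e ?_
    have := ((linearIndependent_codeVector hx ih).comp _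
      MarkedForest.code_injective).units_smul u
    convert this using 1
    funext F
    exact hu F

end Independence

end ModelRing

/-- The canonical monomials of the marked monotonic forests are linearly independent. -/
theorem linearIndependent_monomial {K : Type*} [Field K] {H : Type*} [Ring H] [Algebra K H]
    {𝒜 : ℕ → Submodule K H} {n : ℕ} {ι : Type*} [GradedAlgebra 𝒜]
    (hcomm : ∀ (a b : ℕ) (y z : H), y ∈ 𝒜 a → z ∈ 𝒜 b → y * z = (-1) ^ (a * b) * (z * y))
    {x : ι → H} (hx : LinearIndependent K x) {deg : ι → ℕ} (hdeg : ∀ h, x h ∈ 𝒜 (deg h)) :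
    LinearIndependent K (monomial 𝒜 x : MarkedForest n ι → Model 𝒜 n) := by
  have h : (monomial 𝒜 x : MarkedForest n ι → Model 𝒜 n) = ModelRing.monomial 𝒜 x :=
    funext (ModelRing.coe_monomial 𝒜 x)
  rw [h]
  exact ModelRing.linearIndependent_monomial hcomm hx hdeg

/-! ### Straightening products of generators into monotonic forests -/

section Below

variable {R : Type*} [IdemCommSemiring R]

/-- In an idempotent semiring, `x` is at most a finite sum of elements of `S`. In the semiring of
subspaces of an algebra this says that `x` is contained in the sum of finitely many members of
`S`. -/
def Below (S : Set R) (x : R) : Prop := ∃ y ∈ AddSubmonoid.closure S, x ≤ y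

lemma Below.of_mem {S : Set R} {x : R} (h : x ∈ S) : Below S x :=
  ⟨x, AddSubmonoid.subset_closure h, le_rfl⟩

lemma Below.zero (S : Set R) : Below S 0 := ⟨0, zero_mem _, le_rfl⟩

lemma Below.add {S : Set R} {x y : R} (hx : Below S x) (hy : Below S y) : Below S (x + y) := by
  obtain ⟨x', hx', hxx'⟩ := hx
  obtain ⟨y', hy', hyy'⟩ := hy
  exact ⟨x' + y', add_mem hx' hy', add_le_add hxx' hyy'⟩

lemma Below.of_le {S : Set R} {x y : R} (hy : Below S y) (h : x ≤ y) : Below S x := by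
  obtain ⟨z, hz, hyz⟩ := hy
  exact ⟨z, hz, h.trans hyz⟩

lemma Below.mul_of_forall {S S' : Set R} {x y : R} (hx : Below S x)
    (h : ∀ s ∈ S, Below S' (s * y)) : Below S' (x * y) := by
  obtain ⟨z, hz, hxz⟩ := hx
  refine Below.of_le ?_ (mul_le_mul_left hxz y)
  clear hxz
  induction hz using AddSubmonoid.closure_induction with
  | mem s hs => exact h s hs
  | zero => simpa using Below.zero S'
  | add a b _ _ ha hb => simpa [add_mul] using ha.add hb

lemma Below.trans {S S' : Set R} {x : R} (hx : Below S x) (h : ∀ s ∈ S, Below S' s) :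
    Below S' x := by
  simpa using hx.mul_of_forall (y := 1) (S' := S') (by simpa using h)

/-- Elements `g i j` of an idempotent commutative semiring which satisfy the relations of the
subspaces spanned by the generators `G_{ij}`. -/
structure ArnoldSystem {n : ℕ} (g : Fin n → Fin n → R) : Prop where
  diag : ∀ i, g i i = 0
  symm : ∀ i j, g j i = g i j
  sq : ∀ i j, g i j * g i j = 0
  arnold : ∀ i j k, g i k * g j k ≤ g i j * g j k + g i j * g i k

end Below

section Link

variable {V : Type*}

/-- The finest equivalence relation in which `i` and `j` are related. -/
def link (i j : V) : Setoid V := Relation.EqvGen.setoid fun a b => a = i ∧ b = j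

lemma link_le_iff {i j : V} {s : Setoid V} : link i j ≤ s ↔ s i j := by
  constructor
  · intro h
    exact h (Relation.EqvGen.rel i j ⟨rfl, rfl⟩)
  · intro h
    refine Setoid.eqvGen_le ?_
    rintro a b ⟨rfl, rfl⟩
    exact h

lemma link_rel (i j : V) : link i j i j := link_le_iff.1 le_rfl

lemma link_comm (i j : V) : link i j = link j i :=
  le_antisymm (link_le_iff.2 (Setoid.symm' _ (link_rel j i)))
    (link_le_iff.2 (Setoid.symm' _ (link_rel i j)))

lemma link_sup_link (i j k : V) : link i k ⊔ link j k = link i j ⊔ link j k := by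
  refine le_antisymm (sup_le (link_le_iff.2 ?_) le_sup_right)
    (sup_le (link_le_iff.2 ?_) le_sup_right)
  · exact Setoid.trans' _ (link_le_iff.1 (le_sup_left (a := link i j)))
      (link_le_iff.1 (le_sup_right (a := link i j)))
  · exact Setoid.trans' _ (link_le_iff.1 (le_sup_left (a := link i k)))
      (Setoid.symm' _ (link_le_iff.1 (le_sup_right (a := link i k))))

end Link

section Straightening

variable {n : ℕ}

/-- A parent function is monotonic if all parents are smaller than their children. -/
def IsMonotonic (f : Fin n → Option (Fin n)) : Prop := ∀ i j, f j = some i → i < j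

/-- The product over all edges `{i, j}`, `i` the parent of `j`, of elements `g i j`. -/
def edgeProd {R : Type*} [CommMonoid R] (g : Fin n → Fin n → R) (f : Fin n → Option (Fin n)) : R :=
  ∏ j, (f j).elim 1 fun i => g i j

/-- The partition of the vertices into components. -/
def conn (f : Fin n → Option (Fin n)) : Setoid (Fin n) := ⨆ j, (f j).elim ⊥ fun i => link i j

/-- The number of edges. -/
def edgeCount (f : Fin n → Option (Fin n)) : ℕ := ∑ j, (f j).elim 0 fun _ => 1

lemma conn_le_iff {f : Fin n → Option (Fin n)} {s : Setoid (Fin n)} :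
    conn f ≤ s ↔ ∀ i j, f j = some i → s i j := by
  rw [conn, iSup_le_iff]
  constructor
  · intro h i j hij
    have := h j
    rw [hij] at this
    exact link_le_iff.1 this
  · intro h j
    cases hj : f j with
    | none => exact bot_le
    | some i => exact link_le_iff.2 (h i j hj)

lemma conn_of_parent {f : Fin n → Option (Fin n)} {i j : Fin n} (h : f j = some i) :
    conn f i j := conn_le_iff.1 le_rfl i j h

section Update

variable {f : Fin n → Option (Fin n)} {j : Fin n} (hj : f j = none) (i : Fin n)

include hj

lemma edgeProd_update {R : Type*} [CommMonoid R] (g : Fin n → Fin n → R) :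
    edgeProd g (Function.update f j (some i)) = edgeProd g f * g i j := by
  unfold edgeProd
  rw [← Finset.mul_prod_erase _ _ (Finset.mem_univ j),
    ← Finset.mul_prod_erase Finset.univ (fun j => (f j).elim 1 fun i => g i j) (Finset.mem_univ j)]
  rw [Finset.prod_congr rfl (g := fun j => (f j).elim 1 fun i => g i j)]
  · simp [hj, mul_comm]
  · intro k hk
    rw [Function.update_of_ne (Finset.ne_of_mem_erase hk)]

lemma edgeCount_update : edgeCount (Function.update f j (some i)) = edgeCount f + 1 :=
  edgeProd_update (R := Multiplicative ℕ) hj i fun _ _ => Multiplicative.ofAdd 1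

lemma conn_update : conn (Function.update f j (some i)) = conn f ⊔ link i j := by
  refine le_antisymm (conn_le_iff.2 fun a b hab => ?_)
    (sup_le (conn_le_iff.2 fun a b hab => conn_of_parent ?_)
      (link_le_iff.2 (conn_of_parent (by simp))))
  · rcases eq_or_ne b j with rfl | hb
    · obtain rfl : i = a := by simpa using hab
      exact link_le_iff.1 le_sup_right
    · rw [Function.update_of_ne hb] at hab
      exact (le_sup_left : conn f ≤ _) (conn_of_parent hab)
  · rw [Function.update_of_ne]
    · exact hab
    · rintro rfl
      simp [hj] at hab

omit hj in
lemma IsMonotonic.update (hf : IsMonotonic f) (hij : i < j) :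
    IsMonotonic (Function.update f j (some i)) := by
  intro a b hab
  rcases eq_or_ne b j with rfl | hb
  · obtain rfl : i = a := by simpa using hab
    exact hij
  · rw [Function.update_of_ne hb] at hab
    exact hf a b hab

end Update

variable {R : Type*} [IdemCommSemiring R] {g : Fin n → Fin n → R}

/-- Adding an edge `{i, j}`, `i < j`, to a monotonic forest: if `j` already has a parent `k`, the
relation of Arnold for the edges `{k, j}` and `{i, j}` replaces one of them by the edge `{k, i}`,
whose vertices are smaller than `j`. -/
lemma ArnoldSystem.below_edgeProd_mul (hg : ArnoldSystem g) (j : Fin n) :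
    ∀ (i : Fin n) (f : Fin n → Option (Fin n)), IsMonotonic f → i < j →
      Below {x | ∃ f', IsMonotonic f' ∧ conn f' = conn f ⊔ link i j ∧
        edgeCount f' = edgeCount f + 1 ∧ (∀ v, j < v → f' v = f v) ∧ x = edgeProd g f'}
        (edgeProd g f * g i j) := by
  induction j using WellFoundedLT.induction with
  | ind j ih => ?_
  intro i f hf hij
  cases hj : f j with
  | none =>
    exact .of_mem ⟨_, hf.update i hij, conn_update hj i, edgeCount_update hj i,
      fun v hv => Function.update_of_ne hv.ne' _ _, (edgeProd_update hj i g).symm⟩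
  | some k =>
    have hkj := hf k j hj
    set f₀ := Function.update f j none with hf₀
    have hf₀j : f₀ j = none := by simp [hf₀]
    have hf₀m : IsMonotonic f₀ := by
      intro a b hab
      rcases eq_or_ne b j with rfl | hb
      · simp [hf₀] at hab
      · rw [hf₀, Function.update_of_ne hb] at hab
        exact hf a b hab
    have hff : f = Function.update f₀ j (some k) := by
      rw [hf₀, Function.update_idem, ← hj, Function.update_eq_self]
    have hcf : conn f = conn f₀ ⊔ link k j := by rw [hff, conn_update hf₀j]
    have hef : edgeCount f = edgeCount f₀ + 1 := by rw [hff, edgeCount_update hf₀j]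
    have hgf : edgeProd g f = edgeProd g f₀ * g k j := by rw [hff, edgeProd_update hf₀j]
    have hfv (v : Fin n) (hv : j < v) : f₀ v = f v := Function.update_of_ne hv.ne' _ _
    rcases eq_or_ne k i with rfl | hki
    · rw [hgf, mul_assoc, hg.sq, mul_zero]
      exact .zero _
    -- the edge `{k, i}`, in whatever order, can be added to the forest without the edge `{k, j}`
    have hins : Below {x | ∃ f', IsMonotonic f' ∧ conn f' = conn f₀ ⊔ link k i ∧
        edgeCount f' = edgeCount f₀ + 1 ∧ (∀ v, j ≤ v → f' v = f₀ v) ∧ x = edgeProd g f'}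
        (edgeProd g f₀ * g k i) := by
      rcases lt_or_gt_of_ne hki with h | h
      · refine (ih i hij k f₀ hf₀m h).trans fun x ⟨f', h1, h2, h3, h4, h5⟩ =>
          .of_mem ⟨f', h1, h2, h3, fun v hv => h4 v (hij.trans_le hv), h5⟩
      · rw [← hg.symm, link_comm]
        refine (ih k hkj i f₀ hf₀m h).trans fun x ⟨f', h1, h2, h3, h4, h5⟩ =>
          .of_mem ⟨f', h1, h2, h3, fun v hv => h4 v (hkj.trans_le hv), h5⟩
    have hle : edgeProd g f * g i j ≤
        edgeProd g f₀ * g k i * g i j + edgeProd g f₀ * g k i * g k j := by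
      rw [hgf, mul_assoc, mul_assoc, mul_assoc, ← mul_add]
      exact mul_le_mul_right (hg.arnold k i j) _
    have hconn : conn f ⊔ link i j = conn f₀ ⊔ link k i ⊔ link i j := by
      rw [hcf, sup_assoc, sup_assoc, link_sup_link]
    have hconn' : conn f ⊔ link i j = conn f₀ ⊔ link k i ⊔ link k j := by
      rw [hcf, sup_assoc, sup_assoc, sup_comm (link k j), link_sup_link, link_comm i k]
    refine Below.of_le (.add (hins.mul_of_forall ?_) (hins.mul_of_forall ?_)) hle
    · rintro _ ⟨f', h1, h2, h3, h4, rfl⟩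
      have hj' : f' j = none := by rw [h4 j le_rfl, hf₀j]
      refine .of_mem ⟨Function.update f' j (some i), h1.update i hij, ?_, ?_, fun v hv => ?_, ?_⟩
      · rw [conn_update hj', h2, hconn]
      · rw [edgeCount_update hj', h3, hef]
      · rw [Function.update_of_ne hv.ne', h4 v hv.le, hfv v hv]
      · rw [edgeProd_update hj']
    · rintro _ ⟨f', h1, h2, h3, h4, rfl⟩
      have hj' : f' j = none := by rw [h4 j le_rfl, hf₀j]
      refine .of_mem ⟨Function.update f' j (some k), h1.update k hkj, ?_, ?_, fun v hv => ?_, ?_⟩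
      · rw [conn_update hj', h2, hconn']
      · rw [edgeCount_update hj', h3, hef]
      · rw [Function.update_of_ne hv.ne', h4 v hv.le, hfv v hv]
      · rw [edgeProd_update hj']

/-- Straightening: a product of elements `g i j` over arbitrary edges lies below the products over
the monotonic forests which have the same components and the same number of edges. -/
theorem ArnoldSystem.below_prod (hg : ArnoldSystem g) {J : Type*}
    (s : Finset J) (e : J → Option (Fin n × Fin n)) :
    Below {x | ∃ f, IsMonotonic f ∧ conn f = s.sup (fun j => (e j).elim ⊥ fun a => link a.1 a.2) ∧
      edgeCount f = ∑ j ∈ s, (e j).elim 0 (fun _ => 1) ∧ x = edgeProd g f}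
      (∏ j ∈ s, (e j).elim 1 fun a => g a.1 a.2) := by
  classical
  induction s using Finset.induction_on with
  | empty =>
    refine .of_mem ⟨fun _ => none, fun i j h => by simp at h, ?_, ?_, ?_⟩
    · exact le_bot_iff.1 (conn_le_iff.2 fun i j h => by simp at h)
    · simp [edgeCount]
    · simp [edgeProd]
  | insert j s hjs ih =>
    rw [Finset.prod_insert hjs, Finset.sum_insert hjs, Finset.sup_insert]
    cases hj : e j with
    | none => simpa using ih
    | some a =>
      obtain ⟨a, b⟩ := a
      rw [mul_comm]
      refine ih.mul_of_forall ?_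
      rintro _ ⟨f, h1, h2, h3, rfl⟩
      simp only [Option.elim_some]
      have key (a b : Fin n) (hab : a < b) : Below {x | ∃ f', IsMonotonic f' ∧
          conn f' = link a b ⊔ s.sup (fun j => (e j).elim ⊥ fun a => link a.1 a.2) ∧
          edgeCount f' = 1 + ∑ j ∈ s, (e j).elim 0 (fun _ => 1) ∧ x = edgeProd g f'}
          (edgeProd g f * g a b) := by
        refine (hg.below_edgeProd_mul b a f h1 hab).trans ?_
        rintro _ ⟨f', h1', h2', h3', -, rfl⟩
        exact .of_mem ⟨f', h1', by rw [h2', h2, sup_comm], by rw [h3', h3, add_comm], rfl⟩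
      rcases lt_trichotomy a b with hab | rfl | hab
      · exact key a b hab
      · rw [hg.diag, mul_zero]
        exact .zero _
      · rw [← hg.symm, link_comm]
        exact key b a hab

/-- The elements `π i x`, which can be moved along the edges of a forest, can be moved within the
components. -/
lemma mul_edgeProd_eq_of_conn {X : Type*} {π : Fin n → X → R}
    (hπ : ∀ i j x, π j x * g i j = π i x * g i j) (f : Fin n → Option (Fin n)) {a b : Fin n}
    (hab : conn f a b) (x : X) : π a x * edgeProd g f = π b x * edgeProd g f := by
  have : conn f ≤ Setoid.ker fun a => π a x * edgeProd g f := by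
    refine conn_le_iff.2 fun i j hij => ?_
    change π i x * edgeProd g f = π j x * edgeProd g f
    unfold edgeProd
    rw [← Finset.mul_prod_erase _ _ (Finset.mem_univ j), hij, Option.elim_some, ← mul_assoc,
      ← mul_assoc, hπ]
  exact this hab

lemma prod_mul_edgeProd_eq_of_conn {X J : Type*} {π : Fin n → X → R}
    (hπ : ∀ i j x, π j x * g i j = π i x * g i j) (f : Fin n → Option (Fin n)) (s : Finset J)
    (a b : J → Fin n) (x : J → X) (hab : ∀ j ∈ s, conn f (a j) (b j)) :
    (∏ j ∈ s, π (a j) (x j)) * edgeProd g f = (∏ j ∈ s, π (b j) (x j)) * edgeProd g f := by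
  classical
  induction s using Finset.induction_on with
  | empty => rfl
  | insert j s hjs ih =>
    rw [Finset.prod_insert hjs, Finset.prod_insert hjs, mul_assoc,
      ih fun k hk => hab k (Finset.mem_insert_of_mem hk), mul_left_comm,
      mul_edgeProd_eq_of_conn hπ f (hab j (Finset.mem_insert_self _ _)), mul_left_comm, mul_assoc]

end Straightening

section Root

variable {n : ℕ} {f : Fin n → Option (Fin n)} (hf : IsMonotonic f)

/-- The smallest vertex of the component of a vertex in a monotonic forest. -/
def rootOf (v : Fin n) : Fin n :=
  match h : f v with
  | none => v
  | some u => have := hf u v h; rootOf u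
termination_by v

lemma rootOf_of_none {v : Fin n} (h : f v = none) : rootOf hf v = v := by
  rw [rootOf]
  split
  · rfl
  · simp_all

lemma rootOf_of_some {u v : Fin n} (h : f v = some u) : rootOf hf v = rootOf hf u := by
  rw [rootOf]
  split
  · simp_all
  · simp_all

lemma rootOf_induction {P : Fin n → Prop} (hf : IsMonotonic f) (none : ∀ v, f v = none → P v)
    (some : ∀ u v, f v = some u → P u → P v) (v : Fin n) : P v := by
  induction v using WellFoundedLT.induction with
  | ind v ih =>
    cases h : f v with
    | none => exact none v h
    | some u => exact some u v h (ih u (hf u v h))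

lemma rootOf_le (v : Fin n) : rootOf hf v ≤ v := by
  induction v using rootOf_induction hf with
  | none v h => rw [rootOf_of_none hf h]
  | some u v h ih => rw [rootOf_of_some hf h]; exact ih.trans (hf u v h).le

lemma parent_rootOf (v : Fin n) : f (rootOf hf v) = none := by
  induction v using rootOf_induction hf with
  | none v h => rw [rootOf_of_none hf h, h]
  | some u v h ih => rw [rootOf_of_some hf h]; exact ih

lemma rootOf_eq_self_iff {v : Fin n} : rootOf hf v = v ↔ f v = none :=
  ⟨fun h => h ▸ parent_rootOf hf v, rootOf_of_none hf⟩

lemma rootOf_rootOf (v : Fin n) : rootOf hf (rootOf hf v) = rootOf hf v :=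
  rootOf_of_none hf (parent_rootOf hf v)

lemma conn_rootOf (v : Fin n) : conn f (rootOf hf v) v := by
  induction v using rootOf_induction hf with
  | none v h => rw [rootOf_of_none hf h]
  | some u v h ih => rw [rootOf_of_some hf h]; exact Setoid.trans' _ ih (conn_of_parent h)

lemma conn_iff {a b : Fin n} : conn f a b ↔ rootOf hf a = rootOf hf b := by
  constructor
  · intro h
    have : conn f ≤ Setoid.ker (rootOf hf) := conn_le_iff.2 fun i j hij =>
      (rootOf_of_some hf hij).symm
    exact this h
  · intro h
    have := conn_rootOf hf a
    rw [h] at this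
    exact Setoid.trans' _ (Setoid.symm' _ this) (conn_rootOf hf b)

end Root

/-! ### Straightening trees into paths -/

section Paths

variable {n : ℕ} {R : Type*} [IdemCommSemiring R]

/-- The product of the elements `g a b` over the consecutive vertices `a`, `b` of a path. -/
def pathProd (g : Fin n → Fin n → R) : List (Fin n) → R
  | [] => 1
  | [_] => 1
  | a :: b :: l => g a b * pathProd g (b :: l)

lemma pathProd_append (g : Fin n → Fin n → R) (l₁ : List (Fin n)) (a : Fin n) (l₂ : List (Fin n)) :
    pathProd g (l₁ ++ a :: l₂) = pathProd g (l₁ ++ [a]) * pathProd g (a :: l₂) := by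
  induction l₁ with
  | nil => simp [pathProd]
  | cons b l₁ ih =>
    cases l₁ with
    | nil => simp [pathProd]
    | cons c l₁ =>
      simp only [List.cons_append, pathProd, mul_assoc] at ih ⊢
      rw [ih]

lemma head?_append_cons {α : Type*} (l₁ l₂ l₃ : List α) (a : α) :
    (l₁ ++ a :: l₂).head? = (l₁ ++ a :: l₃).head? := by
  cases l₁ <;> rfl

variable {g : Fin n → Fin n → R}

/-- A further vertex `v` attached to a vertex `a` of a path is inserted into the path somewhere
after `a`: if `a` is followed by `b`, the relation of Arnold for the edges `{v, a}` and `{b, a}`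
either inserts `v` between the two or attaches it to `b`. -/
lemma ArnoldSystem.below_pathProd_mul (hg : ArnoldSystem g) (v : Fin n) (l₂ : List (Fin n)) :
    ∀ (l₁ : List (Fin n)) (a : Fin n),
      Below {x | ∃ l, l.Perm (v :: (l₁ ++ a :: l₂)) ∧ l.head? = (l₁ ++ a :: l₂).head? ∧
        x = pathProd g l} (pathProd g (l₁ ++ a :: l₂) * g a v) := by
  induction l₂ with
  | nil =>
    intro l₁ a
    refine .of_mem ⟨l₁ ++ [a, v], ?_, head?_append_cons _ _ _ _, ?_⟩
    · rw [List.append_cons]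
      exact List.perm_append_singleton _ _
    · rw [pathProd_append g l₁ a [v]]
      simp [pathProd]
  | cons b l₂ ih =>
    intro l₁ a
    have h1 := ih (l₁ ++ [a]) b
    simp only [List.append_assoc, List.singleton_append] at h1
    have h2 : Below {x | ∃ l, l.Perm (v :: (l₁ ++ a :: b :: l₂)) ∧
        l.head? = (l₁ ++ a :: b :: l₂).head? ∧ x = pathProd g l}
        (pathProd g (l₁ ++ a :: v :: b :: l₂)) := by
      refine .of_mem ⟨_, ?_, head?_append_cons _ _ _ _, rfl⟩
      rw [List.append_cons, List.append_cons l₁ a (b :: l₂)]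
      exact List.perm_middle
    refine (h1.add h2).of_le ?_
    rw [pathProd_append g l₁ a (b :: l₂), pathProd_append g l₁ a (v :: b :: l₂)]
    simp only [pathProd]
    calc pathProd g (l₁ ++ [a]) * (g a b * pathProd g (b :: l₂)) * g a v
        = pathProd g (l₁ ++ [a]) * pathProd g (b :: l₂) * (g v a * g b a) := by
          rw [← hg.symm v a, ← hg.symm b a]; ring
      _ ≤ pathProd g (l₁ ++ [a]) * pathProd g (b :: l₂) * (g v b * g b a + g v b * g v a) :=
          mul_le_mul_right (hg.arnold v b a) _
      _ = _ := by
          rw [← hg.symm v a, ← hg.symm b a, ← hg.symm v b]; ring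

/-- A product over the edges of a monotonic forest lies below the products over the systems of
paths which have the same components, and which start at the roots of the forest. -/
theorem ArnoldSystem.below_edgeProd_paths (hg : ArnoldSystem g) {f : Fin n → Option (Fin n)}
    (hf : IsMonotonic f) :
    Below {x | ∃ w : Fin n → List (Fin n), (∀ r, (w r).Nodup) ∧
      (∀ r v, v ∈ w r ↔ rootOf hf v = r) ∧ (∀ r, f r = none → (w r).head? = some r) ∧
      x = ∏ r, pathProd g (w r)} (edgeProd g f) := by
  have key (k : ℕ) (hk : k ≤ n) :
      Below {x | ∃ w : Fin n → List (Fin n), (∀ r, (w r).Nodup) ∧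
        (∀ r v, v ∈ w r ↔ (v : ℕ) < k ∧ rootOf hf v = r) ∧
        (∀ r : Fin n, (r : ℕ) < k → f r = none → (w r).head? = some r) ∧
        x = ∏ r, pathProd g (w r)}
        (∏ j with ((j : Fin n) : ℕ) < k, (f j).elim 1 fun i => g i j) := by
    induction k with
    | zero => exact .of_mem ⟨fun _ => [], by simp, by simp, by simp, by simp [pathProd]⟩
    | succ k ih =>
      set v : Fin n := ⟨k, hk⟩ with hv
      have hlt (j : Fin n) : (j : ℕ) < k + 1 ↔ j = v ∨ (j : ℕ) < k := by
        rw [hv, Fin.ext_iff, Nat.lt_succ_iff_lt_or_eq, or_comm]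
      have hfilter : (Finset.univ.filter fun j : Fin n => (j : ℕ) < k + 1) =
          insert v (Finset.univ.filter fun j : Fin n => (j : ℕ) < k) := by
        ext j
        simp [hlt]
      have hupdate (w : Fin n → List (Fin n)) (r : Fin n) (l : List (Fin n)) :
          ∏ s, pathProd g (Function.update w r l s) =
            pathProd g l * ∏ s ∈ Finset.univ.erase r, pathProd g (w s) := by
        rw [← Finset.mul_prod_erase _ _ (Finset.mem_univ r), Function.update_self]
        congr 1
        exact Finset.prod_congr rfl fun s hs => by
          rw [Function.update_of_ne (Finset.ne_of_mem_erase hs)]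
      rw [hfilter, Finset.prod_insert (by simp [hv]), mul_comm]
      refine (ih (by omega)).mul_of_forall ?_
      rintro _ ⟨w, h1, h2, h3, rfl⟩
      cases hfv : f v with
      | none =>
        have hroot := rootOf_of_none hf hfv
        have hwv : w v = [] := by
          refine List.eq_nil_iff_forall_not_mem.2 fun u hu => ?_
          obtain ⟨hu1, hu2⟩ := (h2 v u).1 hu
          have := rootOf_le hf u
          rw [hu2, Fin.le_def, hv] at this
          simp only at this
          omega
        refine .of_mem ⟨Function.update w v [v], fun r => ?_, fun r u => ?_, fun r hr hr' => ?_, ?_⟩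
        · rcases eq_or_ne r v with rfl | hr
          · simp
          · rw [Function.update_of_ne hr]; exact h1 r
        · rw [hlt]
          rcases eq_or_ne r v with rfl | hr
          · have := h2 v u
            rw [hwv] at this
            simp only [List.not_mem_nil, false_iff] at this
            simp only [Function.update_self, List.mem_singleton]
            constructor
            · rintro rfl; exact ⟨.inl rfl, hroot⟩
            · rintro ⟨h | h, h'⟩
              · exact h
              · exact absurd ⟨h, h'⟩ this
          · rw [Function.update_of_ne hr, h2]
            constructor
            · rintro ⟨h, h'⟩; exact ⟨.inr h, h'⟩
            · rintro ⟨rfl | h, h'⟩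
              · exact absurd (h'.symm.trans hroot) hr
              · exact ⟨h, h'⟩
        · rcases eq_or_ne r v with rfl | hrv
          · simp
          · rw [Function.update_of_ne hrv]
            exact h3 r (((hlt r).1 hr).resolve_left hrv) hr'
        · rw [hupdate, ← Finset.mul_prod_erase _ _ (Finset.mem_univ v), hwv]
          simp [pathProd]
      | some a =>
        have hav := hf a v hfv
        set r₀ := rootOf hf a with hr₀
        have hroot : rootOf hf v = r₀ := rootOf_of_some hf hfv
        have haw : a ∈ w r₀ := (h2 r₀ a).2 ⟨hav, rfl⟩
        obtain ⟨l₁, l₂, hl⟩ := List.append_of_mem haw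
        rw [Option.elim_some, ← Finset.mul_prod_erase _ _ (Finset.mem_univ r₀), hl, mul_right_comm]
        refine (hg.below_pathProd_mul v l₂ l₁ a).mul_of_forall ?_
        rintro _ ⟨l, hp, hh, rfl⟩
        rw [← hl] at hp hh
        refine .of_mem ⟨Function.update w r₀ l, fun r => ?_, fun r u => ?_, fun r hr hr' => ?_,
          (hupdate w r₀ l).symm⟩
        · rcases eq_or_ne r r₀ with rfl | hr
          · rw [Function.update_self, hp.nodup_iff, List.nodup_cons, h2]
            exact ⟨by simp [hv], h1 _⟩
          · rw [Function.update_of_ne hr]; exact h1 r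
        · rw [hlt]
          rcases eq_or_ne r r₀ with rfl | hr
          · rw [Function.update_self, hp.mem_iff, List.mem_cons, h2]
            constructor
            · rintro (rfl | h)
              · exact ⟨.inl rfl, hroot⟩
              · exact ⟨.inr h.1, h.2⟩
            · rintro ⟨h | h, h'⟩
              · exact .inl h
              · exact .inr ⟨h, h'⟩
          · rw [Function.update_of_ne hr, h2]
            constructor
            · rintro ⟨h, h'⟩; exact ⟨.inr h, h'⟩
            · rintro ⟨rfl | h, h'⟩
              · exact absurd (h'.symm.trans hroot) hr
              · exact ⟨h, h'⟩
        · have hrv : r ≠ v := by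
            rintro rfl
            simp [hfv] at hr'
          have hrk := ((hlt r).1 hr).resolve_left hrv
          rcases eq_or_ne r r₀ with rfl | hr
          · rw [Function.update_self, hh, h3 _ hrk hr']
          · rw [Function.update_of_ne hr, h3 r hrk hr']
  have := key n le_rfl
  simpa [edgeProd] using this

end Paths

/-! ### The type of a marked forest -/

section Types

variable {n : ℕ} {ι : Type*}

namespace MarkedForest

variable (F : MarkedForest n ι)

lemma isMonotonic : IsMonotonic F.parent := F.parent_lt

/-- The smallest vertex of the component of a vertex. -/
def rootOf (v : Fin n) : Fin n := Kriz.rootOf F.isMonotonic v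

lemma conn_iff {a b : Fin n} : conn F.parent a b ↔ F.rootOf a = F.rootOf b :=
  Kriz.conn_iff F.isMonotonic

lemma rootOf_eq_self_iff {v : Fin n} : F.rootOf v = v ↔ F.parent v = none :=
  Kriz.rootOf_eq_self_iff F.isMonotonic

lemma parent_rootOf (v : Fin n) : F.parent (F.rootOf v) = none :=
  Kriz.parent_rootOf F.isMonotonic v

lemma rootOf_rootOf (v : Fin n) : F.rootOf (F.rootOf v) = F.rootOf v :=
  Kriz.rootOf_rootOf F.isMonotonic v

lemma mark_eq_of_conn {a b : Fin n} (h : conn F.parent a b) : F.mark a = F.mark b := by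
  have : conn F.parent ≤ Setoid.ker F.mark :=
    conn_le_iff.2 fun i j hij => (F.mark_parent i j hij).symm
  exact this h

lemma reachable_iff {a b : Fin n} : F.graph.Reachable a b ↔ conn F.parent a b := by
  constructor
  · rintro ⟨w⟩
    induction w with
    | nil => exact Setoid.refl' _ _
    | cons h _ ih =>
      refine Setoid.trans' _ ?_ ih
      obtain ⟨-, h | h⟩ := (SimpleGraph.fromRel_adj _ _ _).1 h
      · exact conn_of_parent h
      · exact Setoid.symm' _ (conn_of_parent h)
  · intro h
    have : conn F.parent ≤ F.graph.reachableSetoid := by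
      refine conn_le_iff.2 fun i j hij => SimpleGraph.Adj.reachable ?_
      exact (SimpleGraph.fromRel_adj _ _ _).2 ⟨(F.parent_lt i j hij).ne, .inl hij⟩
    exact this h

/-- A labelling of the vertices of `F` by the components of the forest of bamboos of type `T`,
which witnesses that `F` is of type `T`. -/
structure IsLabelling [LinearOrder ι] (T : ForestType n ι) (κ : Fin n → Fin T.t) : Prop where
  conn_iff : ∀ a b, conn F.parent a b ↔ κ a = κ b
  card : ∀ i, Fintype.card {v // κ v = i} = T.len i
  mark : ∀ v, F.mark v = T.mark (κ v)

end MarkedForest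

variable [LinearOrder ι]

lemma ForestType.conn_bamboo_iff (T : ForestType n ι) {a b : Fin n} :
    conn T.bamboo.parent a b ↔ (T.vertex.symm a).1 = (T.vertex.symm b).1 := by
  have h (v : Fin n) : T.bamboo.rootOf v =
      T.vertex ⟨(T.vertex.symm v).1, ⟨0, T.len_pos _⟩⟩ := by
    unfold MarkedForest.rootOf
    induction v using rootOf_induction T.bamboo.isMonotonic with
    | none v h =>
      rw [rootOf_of_none _ h]
      have h0 : ((T.vertex.symm v).2 : ℕ) = 0 := by
        by_contra h0
        simp [ForestType.bamboo, ForestType.prev, h0] at h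
      rw [← Equiv.symm_apply_eq]
      exact Sigma.ext rfl (heq_of_eq (Fin.ext h0))
    | some u v h ih =>
      rw [rootOf_of_some _ h, ih, (T.prev_eq_some h).2]
  rw [MarkedForest.conn_iff, h, h, EmbeddingLike.apply_eq_iff_eq]
  constructor
  · intro h
    exact (Sigma.mk.inj_iff.1 h).1
  · intro h
    rw [h]

lemma sameType_bamboo_iff {F : MarkedForest n ι} {T : ForestType n ι} :
    SameType F T.bamboo ↔ ∃ κ, F.IsLabelling T κ := by
  simp only [SameType, MarkedForest.reachable_iff]
  constructor
  · rintro ⟨σ, h1, h2⟩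
    refine ⟨fun v => (T.vertex.symm (σ v)).1, fun a b => ?_, fun i => ?_, fun v => (h2 v).symm⟩
    · rw [h1, T.conn_bamboo_iff]
    · refine (Fintype.card_congr ((σ.trans T.vertex.symm).subtypeEquiv
        (q := fun s : (Σ i : Fin T.t, Fin (T.len i)) => s.1 = i) fun a => Iff.rfl)).trans ?_
      rw [Fintype.card_congr (Equiv.sigmaSubtype i), Fintype.card_fin]
  · rintro ⟨κ, hκ⟩
    have e (i : Fin T.t) : {v // κ v = i} ≃ Fin (T.len i) :=
      Fintype.equivFinOfCardEq (hκ.card i)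
    set σ : Equiv.Perm (Fin n) :=
      ((Equiv.sigmaFiberEquiv κ).symm.trans (Equiv.sigmaCongrRight e)).trans T.vertex with hσ
    have hσκ (v : Fin n) : (T.vertex.symm (σ v)).1 = κ v := by simp [hσ]
    refine ⟨σ, fun a b => ?_, fun v => ?_⟩
    · rw [T.conn_bamboo_iff, hσκ, hσκ, hκ.conn_iff]
    · rw [hκ.mark, ← hσκ]
      rfl

lemma sameType_bamboo_self (T : ForestType n ι) : SameType T.bamboo T.bamboo :=
  ⟨1, fun _ _ => Iff.rfl, fun _ => rfl⟩

namespace MarkedForest.IsLabelling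

variable {F : MarkedForest n ι} {T : ForestType n ι} {κ : Fin n → Fin T.t}
  (hκ : F.IsLabelling T κ)

include hκ

lemma surjective : Function.Surjective κ := by
  intro i
  have h := hκ.card i
  have : 0 < Fintype.card {v // κ v = i} := h ▸ T.len_pos i
  obtain ⟨v, hv⟩ := Fintype.card_pos_iff.1 this
  exact ⟨v, hv⟩

lemma label_rootOf (v : Fin n) : κ (F.rootOf v) = κ v := by
  rw [← hκ.conn_iff, F.conn_iff, F.rootOf_rootOf]

/-- The bijection between the roots of a forest and the components of its forest of bamboos. -/
noncomputable def rootEquiv : {v // F.parent v = none} ≃ Fin T.t :=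
  Equiv.ofBijective (fun v => κ v) (by
    constructor
    · rintro ⟨a, ha⟩ ⟨b, hb⟩ hab
      rw [← hκ.conn_iff, F.conn_iff, F.rootOf_eq_self_iff.2 ha, F.rootOf_eq_self_iff.2 hb] at hab
      exact Subtype.ext hab
    · intro i
      obtain ⟨v, rfl⟩ := hκ.surjective i
      exact ⟨⟨F.rootOf v, F.parent_rootOf v⟩, hκ.label_rootOf v⟩)

lemma rootEquiv_apply (v : {v // F.parent v = none}) : hκ.rootEquiv v = κ v := rfl

lemma label_rootEquiv_symm (i : Fin T.t) : κ (hκ.rootEquiv.symm i) = i := by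
  rw [← hκ.rootEquiv_apply, Equiv.apply_symm_apply]

/-- Products over the roots of a forest are products over the components of its type. -/
lemma prod_roots {M : Type*} [CommMonoid M] (c : Fin n → M) :
    ∏ v, (if F.parent v = none then c v else 1) = ∏ i, c (hκ.rootEquiv.symm i) := by
  rw [← Finset.prod_filter, Finset.prod_subtype (p := fun v => F.parent v = none) _ (by simp)]
  exact (Equiv.prod_comp hκ.rootEquiv.symm fun v => c v).symm

lemma sum_roots_mark (deg : ι → ℕ) :
    ∑ v, (if F.parent v = none then deg (F.mark v) else 0) = T.markDegree deg := by
  rw [show ∑ v, (if F.parent v = none then deg (F.mark v) else 0) =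
    ∑ i, deg (F.mark (hκ.rootEquiv.symm i)) from
    hκ.prod_roots (M := Multiplicative ℕ) fun v => .ofAdd (deg (F.mark v))]
  simp [hκ.mark, hκ.label_rootEquiv_symm, ForestType.markDegree]

lemma edgeCount_eq : edgeCount F.parent = T.lenDegree := by
  have h1 : ∑ v, (if F.parent v = none then 1 else 0) = T.t := by
    rw [show ∑ v, (if F.parent v = none then 1 else 0) = ∑ i : Fin T.t, 1 from
      hκ.prod_roots (M := Multiplicative ℕ) fun _ => .ofAdd 1]
    simp
  have h2 : edgeCount F.parent + ∑ v, (if F.parent v = none then 1 else 0) = n := by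
    rw [edgeCount, ← Finset.sum_add_distrib, Finset.sum_congr rfl (g := fun _ => 1)]
    · simp
    · intro v _
      cases F.parent v <;> rfl
  have h3 : T.lenDegree + T.t = n := by
    have : ∑ i, (T.len i - 1) + ∑ _i : Fin T.t, 1 = ∑ i, T.len i := by
      rw [← Finset.sum_add_distrib]
      exact Finset.sum_congr rfl fun i _ => Nat.sub_add_cancel (T.len_pos i)
    rw [T.sum_len] at this
    simpa [ForestType.lenDegree] using this
  omega

end MarkedForest.IsLabelling

/-- The lengths and marks of a type, as a sequence in a linear order in which it decreases. -/
def ForestType.key (T : ForestType n ι) (i : Fin T.t) : (ℕ ×ₗ ι)ᵒᵈ :=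
  OrderDual.toDual (toLex (T.len i, T.mark i))

lemma ForestType.monotone_key (T : ForestType n ι) : Monotone T.key := by
  intro i j hij
  refine OrderDual.toDual_le_toDual.2 (Prod.Lex.toLex_le_toLex.2 ?_)
  rcases (T.len_anti i j hij).lt_or_eq with h | h
  · exact .inl h
  · exact .inr ⟨h, T.mark_anti i j hij h.symm⟩

/-- A marked forest has only one type: the lengths and marks of `T` and `T'` are rearrangements of
each other, and both are sorted. -/
lemma forestType_unique {F : MarkedForest n ι} {T T' : ForestType n ι}
    (h : SameType F T.bamboo) (h' : SameType F T'.bamboo) : T = T' := by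
  obtain ⟨κ, hκ⟩ := sameType_bamboo_iff.1 h
  obtain ⟨κ', hκ'⟩ := sameType_bamboo_iff.1 h'
  have ht : T.t = T'.t := by
    simpa using Fintype.card_congr (hκ.rootEquiv.symm.trans hκ'.rootEquiv)
  set e := hκ.rootEquiv.symm.trans hκ'.rootEquiv with he
  have hek (v : Fin n) : e (κ v) = κ' v := by
    have h1 : hκ.rootEquiv.symm (κ v) = ⟨F.rootOf v, F.parent_rootOf v⟩ := by
      rw [Equiv.symm_apply_eq, hκ.rootEquiv_apply, hκ.label_rootOf]
    rw [he, Equiv.trans_apply, h1, hκ'.rootEquiv_apply, hκ'.label_rootOf]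
  have hkey (i : Fin T.t) : T'.key (e i) = T.key i := by
    obtain ⟨v, rfl⟩ := hκ.surjective i
    have hm : T'.mark (e (κ v)) = T.mark (κ v) := by rw [hek, ← hκ.mark, ← hκ'.mark]
    have hl : T'.len (e (κ v)) = T.len (κ v) := by
      rw [← hκ.card, ← hκ'.card]
      refine Fintype.card_congr (Equiv.subtypeEquivRight fun u => ?_)
      rw [← hek, EmbeddingLike.apply_eq_iff_eq]
    rw [ForestType.key, ForestType.key, hm, hl]
  have hkey' : T'.key ∘ finCongr ht = T.key := by
    have h1 : T.key = (T'.key ∘ finCongr ht) ∘ (e.trans (finCongr ht).symm) := by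
      funext i
      simp [hkey]
    have h2 : Monotone ((T'.key ∘ finCongr ht) ∘ (e.trans (finCongr ht).symm)) := by
      rw [← h1]; exact T.monotone_key
    have h3 : Monotone ((T'.key ∘ finCongr ht) ∘ (1 : Equiv.Perm (Fin T.t))) :=
      fun i j hij => T'.monotone_key hij
    rw [h1]
    exact Tuple.unique_monotone h3 h2
  clear hkey hek he e hκ hκ' h h'
  obtain ⟨t, len, mark, _, _, _, _⟩ := T
  obtain ⟨t', len', mark', _, _, _, _⟩ := T'
  obtain rfl : t = t' := ht
  have h1 (i : Fin t) : len' i = len i ∧ mark' i = mark i := by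
    simpa [ForestType.key] using congrFun hkey' i
  obtain rfl : len' = len := funext fun i => (h1 i).1
  obtain rfl : mark' = mark := funext fun i => (h1 i).2
  rfl

/-- Every marked monotonic forest has a type. -/
lemma exists_forestType (F : MarkedForest n ι) : ∃ T : ForestType n ι, SameType F T.bamboo := by
  set t := Fintype.card {v // F.parent v = none} with ht
  set key : {v // F.parent v = none} → (ℕ ×ₗ ι)ᵒᵈ := fun r =>
    OrderDual.toDual (toLex (Fintype.card {v // F.rootOf v = r}, F.mark r)) with hkey
  set e : Fin t ≃ {v // F.parent v = none} := (Fintype.equivFin _).symm with he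
  set ρ : Fin t ≃ {v // F.parent v = none} := (Tuple.sort (key ∘ e)).trans e with hρ
  have hmono : Monotone (key ∘ ρ) := by
    have := Tuple.monotone_sort (key ∘ e)
    exact this
  set κ : Fin n → Fin t := fun v => ρ.symm ⟨F.rootOf v, F.parent_rootOf v⟩ with hκ
  have hκi (v : Fin n) (i : Fin t) : κ v = i ↔ F.rootOf v = ρ i := by
    rw [hκ, Equiv.symm_apply_eq, Subtype.ext_iff]
  have hlex (i j : Fin t) (hij : i ≤ j) :=
    Prod.Lex.toLex_le_toLex.1 (OrderDual.toDual_le_toDual.1 (hmono hij))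
  simp only at hlex
  let T : ForestType n ι :=
    { t := t
      len := fun i => Fintype.card {v // κ v = i}
      mark := fun i => F.mark (ρ i)
      len_pos := fun i => Fintype.card_pos_iff.2 ⟨ρ i, by
        rw [hκi, F.rootOf_eq_self_iff]; exact (ρ i).2⟩
      sum_len := by
        rw [← Fintype.card_sigma, Fintype.card_congr (Equiv.sigmaFiberEquiv κ), Fintype.card_fin]
      len_anti := fun i j hij => by
        simp only [hκi]
        rcases hlex i j hij with h | h
        · exact h.le
        · exact h.1.le
      mark_anti := fun i j hij hl => by
        simp only [hκi] at hl
        rcases hlex i j hij with h | h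
        · exact absurd hl h.ne'
        · exact h.2 }
  refine ⟨T, sameType_bamboo_iff.2 ⟨κ, fun a b => ?_, fun i => rfl, fun v => ?_⟩⟩
  · rw [F.conn_iff]
    simp [hκ]
  · have : F.mark v = F.mark (ρ (κ v)) := by
      rw [← (hκi v _).1 rfl]
      refine F.mark_eq_of_conn (F.conn_iff.2 ?_)
      rw [F.rootOf_rootOf]
    exact this

end Types

/-! ### Straightening monomials within their type -/

section Monomials

variable {n : ℕ} {ι : Type*} {R : Type*} [IdemCommSemiring R] {g : Fin n → Fin n → R}

/-- The product of elements `π v x`, `x` the mark of `v`, over the roots `v` of a forest. -/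
def rootProd {X : Type*} (π : Fin n → X → R) (f : Fin n → Option (Fin n)) (mark : Fin n → X) : R :=
  ∏ v, if f v = none then π v (mark v) else 1

lemma prod_le_sum_degree {π : Fin n → ℕ → R} (hone : ∀ v, 1 ≤ π v 0)
    (hmul : ∀ v a b, π v a * π v b ≤ π v (a + b)) (r : Fin n) (s : Finset (Fin n)) (d : Fin n → ℕ) :
    ∏ v ∈ s, π r (d v) ≤ π r (∑ v ∈ s, d v) := by
  induction s using Finset.induction_on with
  | empty => simpa using hone r
  | insert v s hv ih =>
    rw [Finset.prod_insert hv, Finset.sum_insert hv]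
    exact (mul_le_mul_right ih _).trans (hmul _ _ _)

/-- Elements `π v d` at all the vertices can be collected at the roots of a forest. -/
lemma prod_mul_edgeProd_le {π : Fin n → ℕ → R} (hπ : ∀ i j x, π j x * g i j = π i x * g i j)
    (hone : ∀ v, 1 ≤ π v 0) (hmul : ∀ v a b, π v a * π v b ≤ π v (a + b))
    {f : Fin n → Option (Fin n)} (hf : IsMonotonic f) (d : Fin n → ℕ) :
    ∃ D : Fin n → ℕ, ∑ v, (if f v = none then D v else 0) = ∑ v, d v ∧
      (∏ v, π v (d v)) * edgeProd g f ≤ rootProd π f D * edgeProd g f := by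
  have hfib (r : Fin n) (hr : f r ≠ none) :
      (Finset.univ.filter fun v => rootOf hf v = r) = ∅ := by
    refine Finset.filter_eq_empty_iff.2 fun v _ hv => hr ?_
    rw [← hv]
    exact parent_rootOf hf v
  refine ⟨fun r => ∑ v with rootOf hf v = r, d v, ?_, ?_⟩
  · rw [← Finset.sum_fiberwise Finset.univ (rootOf hf) d]
    refine Finset.sum_congr rfl fun r _ => ?_
    split_ifs with h
    · rfl
    · rw [hfib r h, Finset.sum_empty]
  · rw [prod_mul_edgeProd_eq_of_conn hπ f Finset.univ _ (rootOf hf) d fun v _ =>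
      Setoid.symm' _ (conn_rootOf hf v)]
    refine mul_le_mul_left ?_ _
    rw [← Finset.prod_fiberwise Finset.univ (rootOf hf)]
    have : IsOrderedMonoid R :=
      { mul_le_mul_left := fun a b h c => mul_le_mul_left h c }
    refine Finset.prod_le_prod' fun r _ => ?_
    split_ifs with h
    · refine le_of_eq_of_le (Finset.prod_congr rfl fun v hv => ?_)
        (prod_le_sum_degree hone hmul r _ d)
      rw [(Finset.mem_filter.1 hv).2]
    · rw [hfib r h, Finset.prod_empty]

/-- A product of elements `π v d` and `g i j` lies below the corresponding products over monotonic
forests of the same degrees. -/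
theorem ArnoldSystem.below_prod_list (hg : ArnoldSystem g) {π : Fin n → ℕ → R}
    (hπ : ∀ i j x, π j x * g i j = π i x * g i j)
    (hone : ∀ v, 1 ≤ π v 0) (hmul : ∀ v a b, π v a * π v b ≤ π v (a + b))
    (d : Fin n → ℕ) (L : List (Fin n × Fin n)) :
    Below {x | ∃ (f : Fin n → Option (Fin n)) (D : Fin n → ℕ), IsMonotonic f ∧
        edgeCount f = L.length ∧ ∑ v, (if f v = none then D v else 0) = ∑ v, d v ∧
        x = rootProd π f D * edgeProd g f}
      ((∏ v, π v (d v)) * (L.map fun a => g a.1 a.2).prod) := by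
  have hL : (L.map fun a => g a.1 a.2).prod = ∏ j : Fin L.length, g L[j].1 L[j].2 := by
    rw [← List.prod_ofFn]
    congr 1
    exact (List.ofFn_getElem_eq_map L fun a : Fin n × Fin n => g a.1 a.2).symm
  have h := hg.below_prod Finset.univ fun j : Fin L.length => some L[j]
  simp only [Option.elim_some, Finset.sum_const, Finset.card_univ, Fintype.card_fin,
    smul_eq_mul, mul_one] at h
  rw [hL, mul_comm]
  refine h.mul_of_forall ?_
  rintro _ ⟨f, h1, -, h3, rfl⟩
  obtain ⟨D, hD, hle⟩ := prod_mul_edgeProd_le hπ hone hmul h1 d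
  rw [mul_comm]
  exact Below.of_le (.of_mem ⟨f, D, h1, h3, hD, rfl⟩) hle

variable [LinearOrder ι]

/-- The translate of the monomial of a forest by a permutation lies below the monomials of the
forests of the same type. -/
theorem ArnoldSystem.below_translate (hg : ArnoldSystem g) {π : Fin n → ι → R}
    (hπ : ∀ i j x, π j x * g i j = π i x * g i j) {F : MarkedForest n ι} {T : ForestType n ι}
    (hF : SameType F T.bamboo) (σ : Equiv.Perm (Fin n)) :
    Below {x | ∃ F' : MarkedForest n ι, SameType F' T.bamboo ∧
        x = rootProd π F'.parent F'.mark * edgeProd g F'.parent}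
      (rootProd (fun v => π (σ v)) F.parent F.mark *
        edgeProd (fun i j => g (σ i) (σ j)) F.parent) := by
  obtain ⟨κ, hκ⟩ := sameType_bamboo_iff.1 hF
  have h := hg.below_prod Finset.univ fun j => (F.parent j).map fun i => (σ i, σ j)
  have he : ∏ j, ((F.parent j).map fun i => (σ i, σ j)).elim 1 (fun a => g a.1 a.2) =
      edgeProd (fun i j => g (σ i) (σ j)) F.parent := by
    refine Finset.prod_congr rfl fun j _ => ?_
    cases F.parent j <;> rfl
  rw [he] at h
  rw [mul_comm]
  refine h.mul_of_forall ?_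
  rintro _ ⟨f, h1, h2, -, rfl⟩
  have hconn (a b : Fin n) : conn f (σ a) (σ b) ↔ conn F.parent a b := by
    constructor
    · have : conn f ≤ Setoid.comap σ.symm (conn F.parent) := by
        rw [h2]
        refine Finset.sup_le fun j _ => ?_
        cases hj : F.parent j with
        | none => exact bot_le
        | some i =>
          refine link_le_iff.2 ?_
          change conn F.parent (σ.symm (σ i)) (σ.symm (σ j))
          simpa using conn_of_parent hj
      intro hab
      have := this hab
      change conn F.parent (σ.symm (σ a)) (σ.symm (σ b)) at this
      simpa using this
    · have : conn F.parent ≤ Setoid.comap σ (conn f) := by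
        refine conn_le_iff.2 fun i j hij => ?_
        change conn f (σ i) (σ j)
        rw [h2]
        refine link_le_iff.1 ?_
        refine le_trans ?_ (Finset.le_sup (Finset.mem_univ j))
        simp [hij]
      exact fun hab => this hab
  have hconn' (a b : Fin n) : conn f a b ↔ κ (σ.symm a) = κ (σ.symm b) := by
    rw [← hκ.conn_iff, ← hconn, Equiv.apply_symm_apply, Equiv.apply_symm_apply]
  let F' : MarkedForest n ι :=
    { parent := f
      parent_lt := h1
      mark := fun v => F.mark (σ.symm v)
      mark_parent := fun i j hij => by
        rw [hκ.mark, hκ.mark, (hconn' i j).1 (conn_of_parent hij)] }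
  have hκ' : F'.IsLabelling T (fun v => κ (σ.symm v)) :=
    ⟨hconn', fun i => (Fintype.card_congr (σ.symm.subtypeEquiv fun v => Iff.rfl)).trans (hκ.card i),
      fun v => hκ.mark _⟩
  refine .of_mem ⟨F', sameType_bamboo_iff.2 ⟨_, hκ'⟩, ?_⟩
  rw [mul_comm, rootProd, rootProd, hκ.prod_roots, hκ'.prod_roots (c := fun v => π v (F'.mark v))]
  have hm (i : Fin T.t) : F.mark (hκ.rootEquiv.symm i) = F'.mark (hκ'.rootEquiv.symm i) := by
    rw [hκ.mark, hκ'.mark, hκ.label_rootEquiv_symm, hκ'.label_rootEquiv_symm]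
  simp only [hm]
  refine prod_mul_edgeProd_eq_of_conn hπ f _ _ _ _ fun i _ => ?_
  rw [hconn', Equiv.symm_apply_apply, hκ.label_rootEquiv_symm]
  exact (hκ'.label_rootEquiv_symm i).symm

lemma ForestType.bamboo_parent_vertex (T : ForestType n ι) (s : Σ i : Fin T.t, Fin (T.len i)) :
    T.bamboo.parent (T.vertex s) = T.prev s := by
  change T.prev (T.vertex.symm (T.vertex s)) = _
  rw [Equiv.symm_apply_apply]

lemma ForestType.bamboo_mark_vertex (T : ForestType n ι) (s : Σ i : Fin T.t, Fin (T.len i)) :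
    T.bamboo.mark (T.vertex s) = T.mark s.1 := by
  change T.mark (T.vertex.symm (T.vertex s)).1 = _
  rw [Equiv.symm_apply_apply]

lemma pathProd_eq_prod (g : Fin n → Fin n → R) (l : List (Fin n)) :
    pathProd g l = ∏ a : Fin l.length, if h : (a : ℕ) = 0 then 1 else
      g (l[(a : ℕ) - 1]'(by omega)) l[(a : ℕ)] := by
  induction l with
  | nil => simp [pathProd]
  | cons b l ih =>
    cases l with
    | nil => simp [pathProd]
    | cons c l =>
      have h1 : ∏ a : Fin (c :: l).length, (if h : (a : ℕ) = 0 then 1 else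
          g ((c :: l)[(a : ℕ) - 1]'(by omega)) (c :: l)[(a : ℕ)]) =
          ∏ a : Fin l.length, g ((c :: l)[(a : ℕ)]'(by simp)) l[(a : ℕ)] := by
        refine (Fin.prod_univ_succ (n := l.length) _).trans ?_
        simp
      rw [pathProd, ih, h1]
      symm
      refine (Fin.prod_univ_succ (n := l.length + 1) _).trans ?_
      refine (congrArg₂ (· * ·) (dif_pos (Fin.val_zero _))
        (Fin.prod_univ_succ (n := l.length) _)).trans ?_
      simp

/-- The monomial of a forest lies below the translates of the monomial of the forest of bamboos of
its type. -/
theorem ArnoldSystem.below_bamboo (hg : ArnoldSystem g) (π : Fin n → ι → R)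
    {F : MarkedForest n ι} {T : ForestType n ι} (hF : SameType F T.bamboo) :
    Below {x | ∃ σ : Equiv.Perm (Fin n), x = rootProd (fun v => π (σ v)) T.bamboo.parent
        T.bamboo.mark * edgeProd (fun i j => g (σ i) (σ j)) T.bamboo.parent}
      (rootProd π F.parent F.mark * edgeProd g F.parent) := by
  obtain ⟨κ, hκ⟩ := sameType_bamboo_iff.1 hF
  rw [mul_comm]
  refine (hg.below_edgeProd_paths F.isMonotonic).mul_of_forall ?_
  rintro _ ⟨w, h1, h2, h3, rfl⟩
  change ∀ r v, v ∈ w r ↔ F.rootOf v = r at h2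
  set ρ := hκ.rootEquiv.symm with hρ
  have hroot (i : Fin T.t) : F.rootOf (ρ i) = ρ i := F.rootOf_eq_self_iff.2 (ρ i).2
  have hmem (i : Fin T.t) (v : Fin n) : v ∈ w (ρ i) ↔ κ v = i := by
    rw [h2]
    constructor
    · intro h
      rw [← hκ.label_rootOf, h, hρ, hκ.label_rootEquiv_symm]
    · rintro rfl
      rw [← hroot, ← F.conn_iff, hκ.conn_iff, hρ, hκ.label_rootEquiv_symm]
  have hlen (i : Fin T.t) : (w (ρ i)).length = T.len i := by
    rw [← hκ.card, ← List.toFinset_card_of_nodup (h1 _), Fintype.card_subtype]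
    congr 1
    ext v
    simp [hmem]
  -- the `i`-th bamboo is sent onto the path of the `i`-th component
  let φ : (Σ i : Fin T.t, Fin (T.len i)) → Fin n := fun s =>
    (w (ρ s.1))[(s.2 : ℕ)]'(by rw [hlen]; exact s.2.2)
  have hφκ (s) : κ (φ s) = s.1 := (hmem _ _).1 (List.getElem_mem _)
  have hφ : Function.Bijective φ := by
    refine (Fintype.bijective_iff_injective_and_card φ).2 ⟨?_, Fintype.card_congr T.vertex⟩
    rintro ⟨i, a⟩ ⟨j, b⟩ hab
    have hij : i = j := (hφκ ⟨i, a⟩).symm.trans ((congrArg κ hab).trans (hφκ ⟨j, b⟩))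
    subst hij
    have := (List.Nodup.getElem_inj_iff (h1 (ρ i))).1 hab
    exact Sigma.ext rfl (heq_of_eq (Fin.ext this))
  let σ : Equiv.Perm (Fin n) := T.vertex.symm.trans (Equiv.ofBijective φ hφ)
  have hσ (s) : σ (T.vertex s) = φ s := by simp [σ]
  refine .of_mem ⟨σ, ?_⟩
  rw [mul_comm]
  congr 1
  · rw [rootProd, rootProd, hκ.prod_roots, ← Equiv.prod_comp T.vertex, Fintype.prod_sigma]
    refine Finset.prod_congr rfl fun i _ => ?_
    rw [Finset.prod_eq_single (⟨0, T.len_pos i⟩ : Fin (T.len i))]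
    · have h0 : φ ⟨i, ⟨0, T.len_pos i⟩⟩ = ρ i := by
        have := h3 (ρ i) (ρ i).2
        rw [List.head?_eq_getElem?, List.getElem?_eq_some_iff] at this
        exact this.2
      rw [T.bamboo_parent_vertex, T.bamboo_mark_vertex, if_pos (by simp [ForestType.prev]), hσ, h0,
        hκ.mark, hρ, hκ.label_rootEquiv_symm]
    · intro a _ ha
      have : (a : ℕ) ≠ 0 := fun h => ha (Fin.ext h)
      rw [T.bamboo_parent_vertex, if_neg (by simp [ForestType.prev, this])]
    · simp
  · have hpaths : ∏ r, pathProd g (w r) = ∏ i, pathProd g (w (ρ i)) := by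
      rw [← hκ.prod_roots fun r => pathProd g (w r)]
      refine Finset.prod_congr rfl fun r _ => ?_
      split_ifs with h
      · rfl
      · have : w r = [] := List.eq_nil_iff_forall_not_mem.2 fun v hv => h (by
          rw [← (h2 r v).1 hv, F.parent_rootOf])
        rw [this]
        rfl
    rw [hpaths, edgeProd, ← Equiv.prod_comp T.vertex, Fintype.prod_sigma]
    refine Finset.prod_congr rfl fun i _ => ?_
    rw [pathProd_eq_prod]
    refine Fintype.prod_equiv (finCongr (hlen i)) _ _ fun a => ?_
    rw [hσ, T.bamboo_parent_vertex]
    by_cases ha : (a : ℕ) = 0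
    · simp [ForestType.prev, ha]
    · simp only [ForestType.prev, finCongr_apply, Fin.val_cast, ha, dite_false, if_false,
        Option.elim_some, hσ]
      rfl

end Monomials

/-! ### The commutative semiring of lines of the model -/

open scoped Pointwise

universe u v

/-- Commuting elements of an idempotent semiring lie in a commutative one. -/
lemma exists_idemCommSemiring {Q : Type u} [IdemSemiring Q] (S : Set Q)
    (hS : ∀ a ∈ S, ∀ b ∈ S, a * b = b * a) :
    ∃ (R : Type u) (_ : IdemCommSemiring R) (φ : R →+* Q),
      (∀ a b, a ≤ b ↔ φ a ≤ φ b) ∧ S ⊆ Set.range φ := by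
  have hcomm := Subsemiring.isMulCommutative_closure hS
  let C := Subsemiring.closure S
  let inst : IdemCommSemiring C :=
    { IdemSemiring.ofSemiring (α := C) fun a => Subtype.ext (add_idem (a : Q)) with
      mul_comm := fun a b => hcomm.is_comm.comm a b }
  refine ⟨C, inst, C.subtype, fun a b => ?_, fun a ha =>
    ⟨⟨a, Subsemiring.subset_closure ha⟩, rfl⟩⟩
  change a + b = b ↔ (a : Q) ≤ (b : Q)
  rw [Subtype.ext_iff, ← add_eq_right_iff_le]
  rfl

section Span

variable {K : Type*} [Field K] {A : Type*} [Semiring A] [Algebra K A]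

lemma ofFn_prod_span {n : ℕ} (s : Fin n → Set A) :
    (List.ofFn fun i => Submodule.span K (s i)).prod = Submodule.span K (List.ofFn s).prod := by
  induction n with
  | zero => simp [Submodule.one_eq_span_one_set]
  | succ n ih =>
    rw [List.ofFn_succ, List.ofFn_succ, List.prod_cons, List.prod_cons, ih,
      Submodule.span_mul_span]

lemma ofFn_prod_span_singleton {n : ℕ} (a : Fin n → A) :
    (List.ofFn fun i => Submodule.span K {a i}).prod = Submodule.span K {(List.ofFn a).prod} := by
  induction n with
  | zero => simp [Submodule.one_eq_span]
  | succ n ih =>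
    rw [List.ofFn_succ, List.ofFn_succ, List.prod_cons, List.prod_cons, ih,
      Submodule.span_mul_span, Set.singleton_mul_singleton]

lemma ofFn_prod_mem {n : ℕ} {a : Fin n → A} {M : Fin n → Submodule K A} (h : ∀ i, a i ∈ M i) :
    (List.ofFn a).prod ∈ (List.ofFn M).prod := by
  induction n with
  | zero => simp [Submodule.one_eq_span]
  | succ n ih =>
    rw [List.ofFn_succ, List.ofFn_succ, List.prod_cons, List.prod_cons]
    exact Submodule.mul_mem_mul (h 0) (ih fun i => h i.succ)

variable {R : Type*} [IdemCommSemiring R] {φ : R →+* Submodule K A}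

lemma map_prod_eq_ofFn {n : ℕ} (r : Fin n → R) :
    φ (∏ i, r i) = (List.ofFn fun i => φ (r i)).prod := by
  rw [← List.prod_ofFn, map_list_prod, List.map_ofFn]
  rfl

lemma map_prod_eq_span {n : ℕ} {r : Fin n → R} {a : Fin n → A}
    (h : ∀ i, φ (r i) = Submodule.span K {a i}) :
    φ (∏ i, r i) = Submodule.span K {(List.ofFn a).prod} := by
  rw [map_prod_eq_ofFn, ← ofFn_prod_span_singleton]
  simp only [h]

lemma Below.map_le (hφ : ∀ a b, a ≤ b → φ a ≤ φ b) {S : Set R} {r : R} (h : Below S r)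
    {N : Submodule K A} (hS : ∀ s ∈ S, φ s ≤ N) : φ r ≤ N := by
  obtain ⟨y, hy, hry⟩ := h
  refine (hφ _ _ hry).trans ?_
  clear hry
  induction hy using AddSubmonoid.closure_induction with
  | mem s hs => exact hS s hs
  | zero => simp
  | add a b _ _ ha hb => rw [map_add]; exact sup_le ha hb

/-- Subspaces whose elements commute up to units commute in the semiring of subspaces. -/
lemma mul_comm_of_forall {M N : Submodule K A}
    (h : ∀ a ∈ M, ∀ b ∈ N, ∃ c : Kˣ, a * b = c • (b * a)) : M * N = N * M := by
  refine le_antisymm (Submodule.mul_le.2 fun a ha b hb => ?_)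
    (Submodule.mul_le.2 fun b hb a ha => ?_)
  · obtain ⟨c, hc⟩ := h a ha b hb
    rw [hc]
    exact Submodule.smul_mem _ _ (Submodule.mul_mem_mul hb ha)
  · obtain ⟨c, hc⟩ := h a ha b hb
    rw [← inv_smul_eq_iff.2 hc]
    exact Submodule.smul_mem _ _ (Submodule.mul_mem_mul ha hb)

end Span

section Homogeneous

variable {K : Type*} [Field K] {H : Type*} [Ring H] [Algebra K H] {𝒜 : ℕ → Submodule K H}
  [GradedAlgebra 𝒜]

/-- A homogeneous component is spanned by the basis vectors of its degree. -/
lemma homogeneous_eq_span {ι : Type*} (x : Module.Basis ι K H) {deg : ι → ℕ}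
    (hdeg : ∀ h, x h ∈ 𝒜 (deg h)) (d : ℕ) :
    𝒜 d = Submodule.span K {y | ∃ h, deg h = d ∧ y = x h} := by
  refine le_antisymm (fun y hy => ?_) (Submodule.span_le.2 ?_)
  · -- apply the projection onto the component to the expansion of `y` in the basis
    have h1 : ModelRing.gradedLift 𝒜
        (fun e => if e = d then LinearMap.id else (0 : H →ₗ[K] H)) y = y := by
      rw [ModelRing.gradedLift_apply 𝒜 _ hy]
      simp
    rw [← h1, ← x.linearCombination_repr y, Finsupp.linearCombination_apply, Finsupp.sum, map_sum]
    refine Submodule.sum_mem _ fun h _ => ?_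
    rw [map_smul, ModelRing.gradedLift_apply 𝒜 _ (hdeg h)]
    split_ifs with hd
    · exact Submodule.smul_mem _ _ (Submodule.subset_span ⟨h, hd, rfl⟩)
    · simp
  · rintro _ ⟨h, rfl, rfl⟩
    exact hdeg h

end Homogeneous

section System

variable {K : Type u} [Field K] {H : Type v} [Ring H] [Algebra K H] (𝒜 : ℕ → Submodule K H)
  {n : ℕ} {ι : Type*}

/-- The map `y ↦ p_i^*(y)`. -/
noncomputable def pHom (i : Fin n) : H →ₗ[K] Model 𝒜 n where
  toFun := p 𝒜 i
  map_add' := p_add 𝒜 i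
  map_smul' := p_smul 𝒜 i

variable [GradedAlgebra 𝒜]

lemma exists_p_mul_p
    (hcomm : ∀ (a b : ℕ) (y z : H), y ∈ 𝒜 a → z ∈ 𝒜 b → y * z = (-1) ^ (a * b) * (z * y))
    (i j : Fin n) {a b : ℕ} {y z : H} (hy : y ∈ 𝒜 a) (hz : z ∈ 𝒜 b) :
    ∃ c : Kˣ, p 𝒜 i y * p 𝒜 j z = c • (p 𝒜 j z * p 𝒜 i y) := by
  refine ⟨(-1) ^ (a * b), ?_⟩
  have : ModelRing.p 𝒜 i y * ModelRing.p 𝒜 j z =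
      ((-1) ^ (a * b) : Kˣ) • (ModelRing.p 𝒜 j z * ModelRing.p 𝒜 i y) := by
    rw [ModelRing.mul_p hcomm _ j hz, ModelRing.parity_pow_p 𝒜 hy, mul_smul_comm, Units.smul_def]
    simp
  exact this

omit [GradedAlgebra 𝒜] in
lemma exists_G_mul_p (i j k : Fin n) {a : ℕ} {y : H} (hy : y ∈ 𝒜 a) :
    ∃ c : Kˣ, G 𝒜 j k * p 𝒜 i y = c • (p 𝒜 i y * G 𝒜 j k) := by
  refine ⟨(-1) ^ a, ?_⟩
  have : ModelRing.G 𝒜 j k * ModelRing.p 𝒜 i y =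
      ((-1) ^ a : Kˣ) • (ModelRing.p 𝒜 i y * ModelRing.G 𝒜 j k) := by
    rw [ModelRing.G_p_comm 𝒜 i j k hy, Units.smul_def, ← ModelRing.neg_one_pow_smul (K := K)]
    simp
  exact this

omit [GradedAlgebra 𝒜] in
lemma exists_G_mul_G (i j k l : Fin n) :
    ∃ c : Kˣ, G 𝒜 i j * G 𝒜 k l = c • (G 𝒜 k l * G 𝒜 i j) := by
  refine ⟨-1, ?_⟩
  have : ModelRing.G 𝒜 i j * ModelRing.G 𝒜 k l =
      (-1 : Kˣ) • (ModelRing.G 𝒜 k l * ModelRing.G 𝒜 i j) := by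
    rw [ModelRing.G_anticomm, Units.smul_def]
    simp
  exact this

variable {𝒜}

open Submodule in
/-- The lines spanned by the `G_{ij}` and the images under the `p_i^*` of homogeneous subspaces
commute with each other, as the elements themselves commute up to sign. Hence they can be computed
with in a commutative idempotent semiring. -/
theorem exists_semiring_system
    (hcomm : ∀ (a b : ℕ) (y z : H), y ∈ 𝒜 a → z ∈ 𝒜 b → y * z = (-1) ^ (a * b) * (z * y))
    (x : ι → H) {deg : ι → ℕ} (hdeg : ∀ h, x h ∈ 𝒜 (deg h)) (n : ℕ) :
    ∃ (R : Type (max u v)) (_ : IdemCommSemiring R) (φ : R →+* Submodule K (Model 𝒜 n))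
      (g : Fin n → Fin n → R) (π : Fin n → ι → R) (P : Fin n → ℕ → R),
      (∀ a b, a ≤ b → φ a ≤ φ b) ∧
      (∀ i j, φ (g i j) = span K {G 𝒜 i j}) ∧
      (∀ i h, φ (π i h) = span K {p 𝒜 i (x h)}) ∧
      (∀ i d, φ (P i d) = (𝒜 d).map (pHom 𝒜 i)) ∧
      ArnoldSystem g ∧ (∀ i j h, π j h * g i j = π i h * g i j) ∧
      (∀ i j d, P j d * g i j = P i d * g i j) ∧
      (∀ i, 1 ≤ P i 0) ∧ ∀ i a b, P i a * P i b ≤ P i (a + b) := by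
  let S : Set (Submodule K (Model 𝒜 n)) := {M | (∃ i j, M = span K {G 𝒜 i j}) ∨
    ∃ i d U, U ≤ 𝒜 d ∧ M = U.map (pHom 𝒜 i)}
  have hPG (i j k : Fin n) (d : ℕ) (U : Submodule K H) (hU : U ≤ 𝒜 d) :
      span K {G 𝒜 i j} * U.map (pHom 𝒜 k) = U.map (pHom 𝒜 k) * span K {G 𝒜 i j} := by
    refine mul_comm_of_forall ?_
    intro a ha b hb
    obtain ⟨c, rfl⟩ := mem_span_singleton.1 ha
    obtain ⟨y, hy, rfl⟩ := hb
    obtain ⟨u, hu⟩ := exists_G_mul_p 𝒜 k i j (hU hy)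
    refine ⟨u, ?_⟩
    change c • G 𝒜 i j * p 𝒜 k y = u • (p 𝒜 k y * c • G 𝒜 i j)
    rw [smul_mul_assoc, mul_smul_comm, hu, smul_comm]
  have hS : ∀ a ∈ S, ∀ b ∈ S, a * b = b * a := by
    rintro _ (⟨i, j, rfl⟩ | ⟨i, d, U, hU, rfl⟩) _ (⟨k, l, rfl⟩ | ⟨k, e, V, hV, rfl⟩)
    · rw [span_mul_span, span_mul_span, Set.singleton_mul_singleton, Set.singleton_mul_singleton]
      obtain ⟨u, hu⟩ := exists_G_mul_G 𝒜 i j k l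
      rw [hu]
      exact span_singleton_group_smul_eq _ _ _
    · exact hPG i j k e V hV
    · exact (hPG k l i d U hU).symm
    · refine mul_comm_of_forall ?_
      rintro _ ⟨y, hy, rfl⟩ _ ⟨z, hz, rfl⟩
      exact exists_p_mul_p 𝒜 hcomm i k (hU hy) (hV hz)
  obtain ⟨R, hR, φ, hφ, hSφ⟩ := exists_idemCommSemiring S hS
  have hinj {a b : R} (h : φ a = φ b) : a = b :=
    le_antisymm ((hφ a b).2 h.le) ((hφ b a).2 h.ge)
  choose g hg using fun i j => hSφ (show span K {G 𝒜 i j} ∈ S from .inl ⟨i, j, rfl⟩)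
  choose π hπ using fun i h => hSφ (show span K {p 𝒜 i (x h)} ∈ S from
    .inr ⟨i, deg h, span K {x h}, by simpa using hdeg h, by
      rw [map_span, Set.image_singleton]; rfl⟩)
  choose P hP using fun i d => hSφ (show (𝒜 d).map (pHom 𝒜 i) ∈ S from
    .inr ⟨i, d, 𝒜 d, le_rfl, rfl⟩)
  refine ⟨R, hR, φ, g, π, P, fun a b => (hφ a b).1, hg, hπ, hP, ⟨fun i => hinj ?_,
    fun i j => hinj ?_, fun i j => hinj ?_, fun i j k => (hφ _ _).2 ?_⟩, fun i j h => hinj ?_,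
    fun i j d => hinj ?_, fun i => (hφ _ _).2 ?_, fun i a b => (hφ _ _).2 ?_⟩
  · rw [hg, G_diag, map_zero, span_singleton_eq_bot.2 rfl]; rfl
  · rw [hg, hg, G_symm]
  · rw [map_mul, hg, span_mul_span, Set.singleton_mul_singleton, G_sq, map_zero,
      span_singleton_eq_bot.2 rfl]
    rfl
  · rw [map_mul, map_add, map_mul, map_mul, hg, hg, hg]
    simp only [span_mul_span, Set.singleton_mul_singleton]
    rw [span_singleton_le_iff_mem]
    have : G 𝒜 i k * G 𝒜 j k = G 𝒜 i j * G 𝒜 j k + (-1 : K) • (G 𝒜 i j * G 𝒜 i k) := by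
      have : ModelRing.G 𝒜 i k * ModelRing.G 𝒜 j k = ModelRing.G 𝒜 i j * ModelRing.G 𝒜 j k +
          (-1 : K) • (ModelRing.G 𝒜 i j * ModelRing.G 𝒜 i k) := by
        rw [ModelRing.arnold, sub_eq_add_neg, neg_one_smul]
      exact this
    rw [this]
    exact add_mem (mem_sup_left (mem_span_singleton_self _))
      (mem_sup_right (smul_mem _ _ (mem_span_singleton_self _)))
  · rw [map_mul, map_mul, hπ, hπ, hg]
    simp only [span_mul_span, Set.singleton_mul_singleton, p_G]
  · have key (i j k l : Fin n) (h : ∀ y, p 𝒜 k y * G 𝒜 i j = p 𝒜 l y * G 𝒜 i j) :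
        (𝒜 d).map (pHom 𝒜 k) * span K {G 𝒜 i j} ≤ (𝒜 d).map (pHom 𝒜 l) * span K {G 𝒜 i j} := by
      refine mul_le.2 ?_
      rintro _ ⟨y, hy, rfl⟩ b hb
      obtain ⟨c, rfl⟩ := mem_span_singleton.1 hb
      change p 𝒜 k y * c • G 𝒜 i j ∈ _
      rw [mul_smul_comm, h, ← mul_smul_comm]
      exact mul_mem_mul ⟨y, hy, rfl⟩ hb
    rw [map_mul, map_mul, hP, hP, hg]
    exact le_antisymm (key i j j i fun y => p_G 𝒜 i j y) (key i j i j fun y => (p_G 𝒜 i j y).symm)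
  · rw [map_one, hP, one_eq_span, span_singleton_le_iff_mem]
    exact ⟨1, SetLike.GradedOne.one_mem, p_one 𝒜 i⟩
  · rw [map_mul, hP, hP, hP]
    refine mul_le.2 ?_
    rintro _ ⟨y, hy, rfl⟩ _ ⟨z, hz, rfl⟩
    exact ⟨y * z, SetLike.GradedMul.mul_mem hy hz, p_mul 𝒜 i y z⟩

end System

/-! ### Type subspaces and bihomogeneous components -/

section Spanning

variable {K : Type u} [Field K] {H : Type v} [Ring H] [Algebra K H] {𝒜 : ℕ → Submodule K H}
  {n : ℕ} {ι : Type*} {R : Type*} [IdemCommSemiring R] {φ : R →+* Submodule K (Model 𝒜 n)}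
  {g : Fin n → Fin n → R}

lemma map_edgeProd {σ : Fin n → Fin n} (hg : ∀ i j, φ (g i j) = Submodule.span K {G 𝒜 i j})
    (F : MarkedForest n ι) :
    φ (edgeProd (fun i j => g (σ i) (σ j)) F.parent) =
      Submodule.span K {(List.ofFn fun j => match F.parent j with
        | none => 1
        | some i => G 𝒜 (σ i) (σ j)).prod} := by
  refine map_prod_eq_span fun j => ?_
  cases F.parent j with
  | none => simpa using Submodule.one_eq_span
  | some i => exact hg _ _

lemma map_rootProd {σ : Fin n → Fin n} {π : Fin n → ι → R} {x : ι → H}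
    (hπ : ∀ i h, φ (π i h) = Submodule.span K {p 𝒜 i (x h)}) (F : MarkedForest n ι) :
    φ (rootProd (fun v => π (σ v)) F.parent F.mark) =
      Submodule.span K {(List.ofFn fun v => if F.parent v = none then
        p 𝒜 (σ v) (x (F.mark v)) else 1).prod} := by
  refine map_prod_eq_span fun v => ?_
  split_ifs
  · exact hπ _ _
  · simpa using Submodule.one_eq_span

lemma map_monomial (hg : ∀ i j, φ (g i j) = Submodule.span K {G 𝒜 i j})
    {π : Fin n → ι → R} {x : ι → H} (hπ : ∀ i h, φ (π i h) = Submodule.span K {p 𝒜 i (x h)})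
    (F : MarkedForest n ι) :
    φ (rootProd π F.parent F.mark * edgeProd g F.parent) =
      Submodule.span K {monomial 𝒜 x F} := by
  have h1 := map_edgeProd (σ := id) hg F
  have h2 := map_rootProd (σ := id) hπ F
  simp only [id_eq] at h1 h2
  rw [map_mul, h1, h2, Submodule.span_mul_span, Set.singleton_mul_singleton]
  rfl

lemma action_monomial (x : ι → H) (F : MarkedForest n ι) (σ : Equiv.Perm (Fin n)) :
    action 𝒜 n σ (monomial 𝒜 x F) =
      (List.ofFn fun v => if F.parent v = none then p 𝒜 (σ v) (x (F.mark v)) else 1).prod *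
      (List.ofFn fun j => match F.parent j with
        | none => 1
        | some i => G 𝒜 (σ i) (σ j)).prod := by
  change permHom 𝒜 σ (monomial 𝒜 x F) = _
  rw [monomial, map_mul, map_list_prod, map_list_prod, List.map_ofFn, List.map_ofFn]
  congr 3
  · funext v
    simp only [Function.comp_apply]
    split_ifs <;> simp
  · funext j
    simp only [Function.comp_apply]
    cases F.parent j <;> simp

lemma map_translate (hg : ∀ i j, φ (g i j) = Submodule.span K {G 𝒜 i j})
    {π : Fin n → ι → R} {x : ι → H} (hπ : ∀ i h, φ (π i h) = Submodule.span K {p 𝒜 i (x h)})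
    (F : MarkedForest n ι) (σ : Equiv.Perm (Fin n)) :
    φ (rootProd (fun v => π (σ v)) F.parent F.mark *
        edgeProd (fun i j => g (σ i) (σ j)) F.parent) =
      Submodule.span K {action 𝒜 n σ (monomial 𝒜 x F)} := by
  rw [map_mul, map_edgeProd (σ := σ) hg, map_rootProd (σ := σ) hπ, Submodule.span_mul_span,
    Set.singleton_mul_singleton, action_monomial]

variable [LinearOrder ι] [GradedAlgebra 𝒜]
  (hcomm : ∀ (a b : ℕ) (y z : H), y ∈ 𝒜 a → z ∈ 𝒜 b → y * z = (-1) ^ (a * b) * (z * y))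

include hcomm

/-- A translate of a canonical monomial can be straightened without changing the sizes and the
marks of the components. -/
theorem action_mem_typeSubspace {x : ι → H} {deg : ι → ℕ} (hdeg : ∀ h, x h ∈ 𝒜 (deg h))
    (T : ForestType n ι) (σ : Equiv.Perm (Fin n)) {e : Model 𝒜 n} (he : e ∈ typeSubspace 𝒜 x T) :
    action 𝒜 n σ e ∈ typeSubspace 𝒜 x T := by
  obtain ⟨R, _, φ, g, π, -, hφ, hg, hπ, -, hA, hπg, -⟩ := exists_semiring_system hcomm x hdeg n
  have key : typeSubspace 𝒜 x T ≤ (typeSubspace 𝒜 x T).comap (action 𝒜 n σ) := by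
    refine Submodule.span_le.2 ?_
    rintro _ ⟨F, hF, rfl⟩
    have h := (hA.below_translate hπg hF σ).map_le hφ (N := typeSubspace 𝒜 x T) (by
      rintro _ ⟨F', hF', rfl⟩
      rw [map_monomial hg hπ, Submodule.span_singleton_le_iff_mem]
      exact Submodule.subset_span ⟨F', hF', rfl⟩)
    rw [map_translate hg hπ, Submodule.span_singleton_le_iff_mem] at h
    exact h
  exact key he

/-- Straightening the trees of a forest into paths writes its monomial as a combination of
translates of the monomial of the forest of bamboos. -/
theorem span_orbit_bamboo {x : ι → H} {deg : ι → ℕ} (hdeg : ∀ h, x h ∈ 𝒜 (deg h))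
    (T : ForestType n ι) :
    Submodule.span K (Set.range fun σ : Equiv.Perm (Fin n) =>
      action 𝒜 n σ (monomial 𝒜 x T.bamboo)) = typeSubspace 𝒜 x T := by
  refine le_antisymm (Submodule.span_le.2 ?_) (Submodule.span_le.2 ?_)
  · rintro _ ⟨σ, rfl⟩
    exact action_mem_typeSubspace hcomm hdeg T σ
      (Submodule.subset_span ⟨_, sameType_bamboo_self T, rfl⟩)
  · rintro _ ⟨F, hF, rfl⟩
    obtain ⟨R, _, φ, g, π, -, hφ, hg, hπ, -, hA, -⟩ := exists_semiring_system hcomm x hdeg n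
    have h := (hA.below_bamboo π hF).map_le hφ (N := Submodule.span K (Set.range
        fun σ : Equiv.Perm (Fin n) => action 𝒜 n σ (monomial 𝒜 x T.bamboo))) (by
      rintro _ ⟨σ, rfl⟩
      rw [map_translate hg hπ, Submodule.span_singleton_le_iff_mem]
      exact Submodule.subset_span ⟨σ, rfl⟩)
    rw [map_monomial hg hπ, Submodule.span_singleton_le_iff_mem] at h
    exact h

/-- Straightening the `G_{ij}` of a product into a monotonic forest, and collecting its classes at
the roots, preserves both degrees; the classes are then expanded in the basis of `H`. -/
theorem component_le_iSup (x : Module.Basis ι K H) {deg : ι → ℕ} (hdeg : ∀ h, x h ∈ 𝒜 (deg h))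
    (m q : ℕ) (k : ℤ) :
    component 𝒜 m n q k ≤ ⨆ T : {T : ForestType n ι //
      T.lenDegree = q ∧ (T.markDegree deg : ℤ) = k - q * (2 * m - 1)}, typeSubspace 𝒜 x T.1 := by
  obtain ⟨R, _, φ, g, π, P, hφ, hg, hπ, hP, hA, -, hPg, hone, hmul⟩ :=
    exists_semiring_system hcomm x hdeg n
  refine Submodule.span_le.2 ?_
  rintro _ ⟨y, d, L, hy, rfl, hk, rfl⟩
  have hmem : (List.ofFn fun i => p 𝒜 i (y i)).prod * (L.map fun a => G 𝒜 a.1 a.2).prod ∈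
      φ ((∏ v, P v (d v)) * (L.map fun a => g a.1 a.2).prod) := by
    rw [map_mul]
    refine Submodule.mul_mem_mul ?_ ?_
    · rw [map_prod_eq_ofFn]
      exact ofFn_prod_mem fun i => by rw [hP]; exact ⟨y i, hy i, rfl⟩
    · rw [map_list_prod, List.map_map]
      clear hk
      induction L with
      | nil => simp [Submodule.one_eq_span]
      | cons a L ih =>
        rw [List.map_cons, List.map_cons, List.prod_cons, List.prod_cons]
        refine Submodule.mul_mem_mul ?_ ih
        rw [Function.comp_apply, hg]
        exact Submodule.mem_span_singleton_self _
  refine (hA.below_prod_list hPg hone hmul d L).map_le hφ ?_ hmem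
  rintro _ ⟨f, D, hf, hfL, hD, rfl⟩
  -- the factors `G_{ij}` do not depend on marks, so any forest with the parent function `f` will do
  let F₀ : MarkedForest n Unit := ⟨f, hf, fun _ => (), fun _ _ _ => rfl⟩
  have hroot : φ (rootProd P f D) = Submodule.span K (List.ofFn fun v =>
      if f v = none then {e | ∃ h, deg h = D v ∧ e = p 𝒜 v (x h)} else {1}).prod := by
    rw [rootProd, map_prod_eq_ofFn, ← ofFn_prod_span]
    congr 2
    funext v
    split_ifs
    · rw [hP, homogeneous_eq_span x hdeg, Submodule.map_span]
      congr 1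
      ext e
      constructor
      · rintro ⟨_, ⟨h, hh, rfl⟩, rfl⟩
        exact ⟨h, hh, rfl⟩
      · rintro ⟨h, hh, rfl⟩
        exact ⟨_, ⟨h, hh, rfl⟩, rfl⟩
    · rw [map_one, Submodule.one_eq_span]
  have hedge := map_edgeProd (σ := id) hg F₀
  simp only [id_eq] at hedge
  rw [map_mul, hroot, hedge, Submodule.span_mul_span, Submodule.span_le]
  rintro _ ⟨a, ha, _, rfl, rfl⟩
  obtain ⟨c, hcmem, rfl⟩ : ∃ c : Fin n → Model 𝒜 n,
      (∀ v, c v ∈ if f v = none then {e | ∃ h, deg h = D v ∧ e = p 𝒜 v (x h)} else {1}) ∧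
      (List.ofFn c).prod = a := by
    obtain ⟨c, rfl⟩ := Set.mem_prod_list_ofFn.1 ha
    exact ⟨fun v => c v, fun v => (c v).2, rfl⟩
  have hc (v : Fin n) (hv : f v = none) : ∃ h, deg h = D v ∧ c v = p 𝒜 v (x h) := by
    have := hcmem v
    rw [if_pos hv] at this
    exact this
  -- a root gets the mark that is chosen for its class, any other vertex the mark of its root
  choose μ hμ hcμ using hc
  have hmk {u v : Fin n} (hu : f u = none) (hv : f v = none) (huv : u = v) : μ u hu = μ v hv := by
    subst huv; rfl
  let F : MarkedForest n ι := ⟨f, hf, fun v => μ (rootOf hf v) (parent_rootOf hf v),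
    fun i j hij => hmk _ _ (rootOf_of_some hf hij)⟩
  have hmark (v : Fin n) (hv : f v = none) : F.mark v = μ v hv :=
    hmk _ _ (rootOf_of_none hf hv)
  have hmon : (List.ofFn c).prod *
      (List.ofFn fun j => match F₀.parent j with
        | none => 1
        | some i => G 𝒜 i j).prod = monomial 𝒜 x F := by
    refine congrArg₂ (· * ·) (congrArg List.prod (congrArg List.ofFn (funext fun v => ?_))) rfl
    by_cases hv : f v = none
    · rw [if_pos (show F.parent v = none from hv), hmark v hv, hcμ v hv]
    · have := hcmem v
      rw [if_neg hv] at this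
      rw [if_neg (show ¬ F.parent v = none from hv)]
      exact this
  obtain ⟨T, hT⟩ := exists_forestType F
  obtain ⟨κ, hκ⟩ := sameType_bamboo_iff.1 hT
  have hdegT : T.markDegree deg = ∑ v, d v := by
    rw [← hκ.sum_roots_mark, ← hD]
    refine Finset.sum_congr rfl fun v _ => ?_
    by_cases hv : f v = none
    · rw [if_pos (show F.parent v = none from hv), if_pos hv, hmark v hv, hμ]
    · rw [if_neg (show ¬ F.parent v = none from hv), if_neg hv]
  have hlen : T.lenDegree = L.length := by rw [← hκ.edgeCount_eq, ← hfL]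
  refine Submodule.mem_iSup_of_mem ⟨T, hlen, ?_⟩ (Submodule.subset_span ⟨F, hT, hmon⟩)
  rw [hdegT, ← hk]
  push_cast
  ring

omit [LinearOrder ι] [GradedAlgebra 𝒜] hcomm in
/-- The edges of a forest, listed by increasing larger vertex. -/
lemma exists_list_edges (f : Fin n → Option (Fin n)) :
    ∃ L : List (Fin n × Fin n), L.length = edgeCount f ∧
      (List.ofFn fun j => match f j with
        | none => 1
        | some i => G 𝒜 i j).prod = (L.map fun a => G 𝒜 a.1 a.2).prod := by
  have key (l : List (Fin n)) : ∃ L : List (Fin n × Fin n),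
      L.length = (l.map fun j => (f j).elim 0 fun _ => 1).sum ∧
      (l.map fun j => match f j with
        | none => 1
        | some i => G 𝒜 i j).prod = (L.map fun a => G 𝒜 a.1 a.2).prod := by
    induction l with
    | nil => exact ⟨[], rfl, rfl⟩
    | cons j l ih =>
      obtain ⟨L, h1, h2⟩ := ih
      cases hj : f j with
      | none => exact ⟨L, by simp [hj, h1], by simp [hj, h2]⟩
      | some i => exact ⟨(i, j) :: L, by simp [hj, h1, add_comm], by simp [hj, h2]⟩
  obtain ⟨L, h1, h2⟩ := key (List.finRange n)
  refine ⟨L, ?_, ?_⟩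
  · rw [h1, edgeCount, ← List.sum_ofFn, List.ofFn_eq_map]
  · rw [← h2, List.ofFn_eq_map]

omit hcomm in
theorem typeSubspace_le_component {x : ι → H} {deg : ι → ℕ} (hdeg : ∀ h, x h ∈ 𝒜 (deg h))
    (m : ℕ) {q : ℕ} {k : ℤ} {T : ForestType n ι} (hq : T.lenDegree = q)
    (hk : (T.markDegree deg : ℤ) = k - q * (2 * m - 1)) :
    typeSubspace 𝒜 x T ≤ component 𝒜 m n q k := by
  refine Submodule.span_le.2 ?_
  rintro _ ⟨F, hF, rfl⟩
  obtain ⟨κ, hκ⟩ := sameType_bamboo_iff.1 hF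
  obtain ⟨L, hL, hLG⟩ := exists_list_edges (𝒜 := 𝒜) F.parent
  refine Submodule.subset_span ⟨fun v => if F.parent v = none then x (F.mark v) else 1,
    fun v => if F.parent v = none then deg (F.mark v) else 0, L, fun v => ?_, ?_, ?_, ?_⟩
  · dsimp only
    split_ifs
    · exact hdeg _
    · exact SetLike.GradedOne.one_mem
  · rw [hL, hκ.edgeCount_eq, hq]
  · have := hκ.sum_roots_mark deg
    rw [← Nat.cast_sum, this, hk]
    ring
  · rw [← hLG, monomial]
    refine congrArg₂ (· * ·) (congrArg List.prod (congrArg List.ofFn (funext fun v => ?_))) rfl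
    dsimp only
    split_ifs
    · rfl
    · exact (p_one 𝒜 v).symm

end Spanning

/-! ### Cyclic representations of finite groups -/

open scoped MonoidAlgebra

section Representations

variable {K G E V : Type*} [Field K] [Group G] [AddCommGroup E] [Module K E] [AddCommGroup V]
  [Module K V] {ρ : Representation K G E} {θ : Representation K G V}

lemma irreducible_of_isAtom {W : Subrepresentation ρ} (hW : IsAtom W) :
    W.toRepresentation.IsIrreducible := by
  have hW0 : W.toSubmodule ≠ ⊥ := fun h => hW.1 (Subrepresentation.toSubmodule_injective h)
  have : Nontrivial W.toSubmodule := Submodule.nontrivial_iff_ne_bot.2 hW0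
  have : Nontrivial (Subrepresentation W.toRepresentation) :=
    ⟨⊥, ⊤, fun h => bot_ne_top (congrArg Subrepresentation.toSubmodule h)⟩
  refine ⟨fun U => ?_⟩
  let U' : Subrepresentation ρ := ⟨U.toSubmodule.map W.toSubmodule.subtype, by
    rintro g _ ⟨u, hu, rfl⟩
    exact ⟨_, U.apply_mem_toSubmodule g hu, rfl⟩⟩
  have hU' : U' ≤ W := by
    rintro _ ⟨u, -, rfl⟩
    exact u.2
  rcases hW.le_iff.1 hU' with h | h
  · left
    refine Subrepresentation.toSubmodule_injective ?_
    have : U.toSubmodule.map W.toSubmodule.subtype = ⊥ :=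
      congrArg Subrepresentation.toSubmodule h
    refine Submodule.map_injective_of_injective W.toSubmodule.injective_subtype ?_
    exact this.trans (Submodule.map_bot W.toSubmodule.subtype).symm
  · right
    refine Subrepresentation.toSubmodule_injective ?_
    have : U.toSubmodule.map W.toSubmodule.subtype = W.toSubmodule :=
      congrArg Subrepresentation.toSubmodule h
    refine Submodule.map_injective_of_injective W.toSubmodule.injective_subtype ?_
    rw [this]
    exact (Submodule.map_subtype_top _).symm

lemma exists_sSupIndep_sSup_eq {R M : Type*} [Ring R] [AddCommGroup M] [Module R M]
    [IsSemisimpleModule R M] (N : Submodule R M) :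
    ∃ s : Set (Submodule R M), sSupIndep s ∧ sSup s = N ∧ ∀ ⦃a⦄, a ∈ s → IsAtom a :=
  exists_sSupIndep_of_sSup_atoms N (by simpa only [and_comm] using sSup_atoms_le_eq N)

/-- Over a field of characteristic `0`, a finite-dimensional stable subspace for a finite group is a
finite direct sum of irreducible subrepresentations. -/
theorem exists_isIrreducibleDecomposition [Finite G] [CharZero K] (ρ : Representation K G E)
    (M : Subrepresentation ρ) [FiniteDimensional K M.toSubmodule] :
    ∃ (r : ℕ) (W : Fin r → Subrepresentation ρ),
      IsIrreducibleDecomposition ρ M.toSubmodule W := by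
  have : NeZero (Nat.card G : K) := ⟨Nat.cast_ne_zero.2 Nat.card_pos.ne'⟩
  let e : Subrepresentation ρ ≃o Submodule K[G] ρ.asModule :=
    Subrepresentation.subrepresentationSubmoduleOrderIso
  obtain ⟨s, hind, hsup, hatom⟩ := exists_sSupIndep_sSup_eq (e M)
  -- independence only refers to sums of vectors, so the scalars may be restricted to `K`
  have hind' : iSupIndep fun a : s => (e.symm a).toSubmodule := by
    rw [sSupIndep_iff, iSupIndep_iff_finsetSum_eq_zero_imp_eq_zero] at hind
    exact (iSupIndep_iff_finsetSum_eq_zero_imp_eq_zero _).2 hind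
  have hatom' (a : s) : IsAtom (e.symm a) := (e.symm.isAtom_iff _).2 (hatom a.2)
  have hle (a : s) : (e.symm a).toSubmodule ≤ M.toSubmodule := by
    have : e.symm a ≤ M := e.symm_apply_le.2 (hsup ▸ le_sSup a.2)
    exact this
  have hsup' : ⨆ a : s, (e.symm a).toSubmodule = M.toSubmodule := by
    refine le_antisymm (iSup_le hle) ?_
    let N : Subrepresentation ρ := ⟨⨆ a : s, (e.symm a).toSubmodule, fun g v hv => by
      have : ⨆ a : s, (e.symm a).toSubmodule ≤
          (⨆ a : s, (e.symm a).toSubmodule).comap (ρ g) := iSup_le fun a v hv =>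
        Submodule.mem_iSup_of_mem a ((e.symm a).apply_mem_toSubmodule g hv)
      exact this hv⟩
    have : M ≤ N := by
      rw [← e.le_iff_le, ← hsup]
      refine sSup_le fun a ha => ?_
      rw [← e.symm_apply_le]
      exact le_iSup (fun a : s => (e.symm a).toSubmodule) ⟨a, ha⟩
    exact this
  have hne (a : s) : ∃ v : M.toSubmodule, (v : E) ∈ (e.symm a).toSubmodule ∧ (v : E) ≠ 0 := by
    obtain ⟨v, hv, hv0⟩ := Submodule.exists_mem_ne_zero_of_ne_bot
      fun h : (e.symm a).toSubmodule = ⊥ => (hatom' a).1 (Subrepresentation.toSubmodule_injective h)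
    exact ⟨⟨v, hle a hv⟩, hv, hv0⟩
  choose v hv hv0 using hne
  -- nonzero vectors of the summands are independent, so there are finitely many summands
  have hli : LinearIndependent K v :=
    (hind'.linearIndependent _ hv hv0).of_comp M.toSubmodule.subtype
  have : Finite s := hli.finite
  let f := (Finite.equivFin s).symm
  refine ⟨Nat.card s, fun i => e.symm (f i), fun i => irreducible_of_isAtom (hatom' _),
    hind'.comp f.injective, ?_⟩
  rw [← hsup']
  exact f.iSup_comp (g := fun a : s => (e.symm a).toSubmodule)

/-- An irreducible representation of a finite group is finite-dimensional. -/
lemma finiteDimensional_of_isIrreducible [Finite G] (hθ : θ.IsIrreducible) :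
    FiniteDimensional K V := by
  by_cases h : ∃ v : V, v ≠ 0
  · obtain ⟨v, hv⟩ := h
    let U : Subrepresentation θ := ⟨Submodule.span K (Set.range fun g => θ g v), fun g => by
      change _ ≤ (Submodule.span K (Set.range fun g => θ g v)).comap (θ g)
      refine Submodule.span_le.2 ?_
      rintro _ ⟨g', rfl⟩
      refine Submodule.subset_span ⟨g * g', ?_⟩
      exact congrArg (fun f : V →ₗ[K] V => f v) (map_mul θ g g')⟩
    have hvU : v ∈ U.toSubmodule := Submodule.subset_span ⟨1, by simp⟩
    have hU : U = ⊤ := (eq_bot_or_eq_top U).resolve_left fun h => hv (by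
      rw [h] at hvU
      exact hvU)
    refine ⟨⟨(Set.finite_range fun g => θ g v).toFinset, ?_⟩⟩
    rw [Set.Finite.coe_toFinset]
    exact congrArg Subrepresentation.toSubmodule hU
  · push Not at h
    have : Subsingleton V := ⟨fun a b => (h a).trans (h b).symm⟩
    infer_instance

/-- In a representation generated by one vector `v`, an irreducible representation `θ` occurs at
most `dim θ` times: the components of `v` in the summands isomorphic to `θ`, carried to `θ`, are
linearly independent, since an equivariant map which kills `v` is zero. -/
theorem multiplicity_le_finrank [Finite G] {v : E} {r : ℕ} {W : Fin r → Subrepresentation ρ}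
    (hW : IsIrreducibleDecomposition ρ (Submodule.span K (Set.range fun g => ρ g v)) W)
    (hθ : θ.IsIrreducible) : multiplicity W θ ≤ Module.finrank K V := by
  classical
  have := finiteDimensional_of_isIrreducible hθ
  have hV : Nontrivial V := by
    by_contra h
    rw [not_nontrivial_iff_subsingleton] at h
    refine bot_ne_top (α := Subrepresentation θ) (Subrepresentation.toSubmodule_injective ?_)
    exact Subsingleton.elim _ _
  let S := {i : Fin r // Nonempty ((W i).toRepresentation.Equiv θ)}
  let φ (i : S) := i.2.some
  let total : (∀ i, (W i).toSubmodule) →ₗ[K] E :=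
    LinearMap.lsum K (fun i => (W i).toSubmodule) K fun i => (W i).toSubmodule.subtype
  have htotal (u : ∀ i, (W i).toSubmodule) : total u = ∑ i, (u i : E) := by
    simp [total, LinearMap.lsum_apply]
  have hinj (u : ∀ i, (W i).toSubmodule) (hu : total u = 0) : u = 0 := by
    rw [htotal] at hu
    funext i
    exact Subtype.ext ((iSupIndep_iff_finsetSum_eq_zero_imp_eq_zero _).1 hW.indep Finset.univ
      (fun i => (u i : E)) (fun i _ => (u i).2) hu i (Finset.mem_univ i))
  have hv : v ∈ ⨆ i, (W i).toSubmodule := by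
    rw [hW.iSup_eq]
    exact Submodule.subset_span ⟨1, by simp⟩
  obtain ⟨w, hw⟩ : ∃ w, total w = v := by
    obtain ⟨f, hf, hfv⟩ := (Submodule.mem_iSup_iff_exists_finsupp _ _).1 hv
    refine ⟨fun i => ⟨f i, hf i⟩, ?_⟩
    rw [htotal, ← hfv, Finsupp.sum_fintype _ _ fun _ => rfl]
  have hli : LinearIndependent K fun i : S => φ i (w i) := by
    rw [Fintype.linearIndependent_iff]
    intro c hc
    let Φ : (∀ i, (W i).toSubmodule) →ₗ[K] V :=
      ∑ i : S, c i • ((φ i).toLinearMap ∘ₗ LinearMap.proj (i : Fin r))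
    have hΦ (u : ∀ i, (W i).toSubmodule) : Φ u = ∑ i : S, c i • φ i (u i) := by
      simp [Φ]
    -- the equivariant map `Φ` kills the components of `v`, hence those of all its translates
    have hle : ⨆ i, (W i).toSubmodule ≤ (LinearMap.ker Φ).map total := by
      rw [hW.iSup_eq, Submodule.span_le]
      rintro _ ⟨g, rfl⟩
      refine ⟨fun i => (W i).toRepresentation g (w i), ?_, ?_⟩
      · have : ∑ i : S, c i • θ g (φ i (w i)) = 0 := by
          simpa using congrArg (θ g) hc
        rw [SetLike.mem_coe, LinearMap.mem_ker, hΦ, ← this]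
        refine Finset.sum_congr rfl fun i _ => ?_
        congr 1
        exact (φ i).toIntertwiningMap.isIntertwining _ _ g (w i)
      · dsimp only
        rw [← hw, htotal, htotal, map_sum]
        rfl
    intro i
    obtain ⟨y, hy⟩ := exists_ne (0 : V)
    set a := (φ i).symm y with ha
    obtain ⟨u, hu, hua⟩ := hle (Submodule.mem_iSup_of_mem (i : Fin r) a.2)
    have hu' : u = Pi.single (i : Fin r) a := by
      rw [← sub_eq_zero]
      refine hinj _ ?_
      rw [map_sub, hua, htotal, Finset.sum_eq_single (i : Fin r)]
      · simp
      · intro j _ hj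
        rw [Pi.single_eq_of_ne hj]
        rfl
      · simp
    rw [SetLike.mem_coe, LinearMap.mem_ker, hΦ, hu', Finset.sum_eq_single i] at hu
    · simpa [ha, hy] using hu
    · intro j _ hj
      rw [Pi.single_eq_of_ne (fun h => hj (Subtype.ext h)), map_zero, smul_zero]
    · simp
  rw [multiplicity, Nat.card_eq_fintype_card]
  exact hli.fintype_card_le_finrank

end Representations

/-! ### The decomposition of the model -/

section Components

variable {K : Type*} [Field K] {H : Type*} [Ring H] [Algebra K H] {𝒜 : ℕ → Submodule K H}
  {n : ℕ} {ι : Type*} [LinearOrder ι]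

/-- A marked forest has only one type, so distinct type subspaces are spanned by disjoint sets of
independent monomials. -/
lemma iSupIndep_typeSubspace {x : ι → H}
    (h : LinearIndependent K (monomial 𝒜 x : MarkedForest n ι → Model 𝒜 n)) :
    iSupIndep fun T : ForestType n ι => typeSubspace 𝒜 x T := by
  intro T
  have hspan (T : ForestType n ι) : typeSubspace 𝒜 x T =
      Submodule.span K (monomial 𝒜 x '' {F | SameType F T.bamboo}) := by
    rw [typeSubspace]
    congr 1
    ext e
    exact exists_congr fun F => and_congr_right fun _ => eq_comm
  have hle : ⨆ T' ≠ T, typeSubspace 𝒜 x T' ≤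
      Submodule.span K (monomial 𝒜 x '' {F | ¬ SameType F T.bamboo}) := by
    refine iSup₂_le fun T' hT' => ?_
    rw [hspan]
    exact Submodule.span_mono (Set.image_mono fun F hF hF' => hT' (forestType_unique hF hF'))
  refine Disjoint.mono_right hle ?_
  dsimp only
  rw [hspan]
  exact h.disjoint_span_image (Set.disjoint_left.2 fun F hF hF' => hF' hF)

end Components

end Kriz

theorem theorem2p8 {K : Type*} [Field K] [CharZero K]
    {H : Type*} [Ring H] [Algebra K H] (𝒜 : ℕ → Submodule K H) [GradedAlgebra 𝒜]
    (hcomm : ∀ (a b : ℕ) (y z : H), y ∈ 𝒜 a → z ∈ 𝒜 b → y * z = (-1) ^ (a * b) * (z * y))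
    {ι : Type*} [LinearOrder ι] (x : Module.Basis ι K H) (deg : ι → ℕ)
    (hdeg : ∀ h, x h ∈ 𝒜 (deg h)) (m n : ℕ) :
    -- each bihomogeneous component is the direct sum of its type subspaces
    (∀ (q : ℕ) (k : ℤ),
      iSupIndep (fun T : {T : Kriz.ForestType n ι //
          T.lenDegree = q ∧ (T.markDegree deg : ℤ) = k - q * (2 * m - 1)} =>
        Kriz.typeSubspace 𝒜 x T.1) ∧
      (⨆ T : {T : Kriz.ForestType n ι //
          T.lenDegree = q ∧ (T.markDegree deg : ℤ) = k - q * (2 * m - 1)},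
        Kriz.typeSubspace 𝒜 x T.1) = Kriz.component 𝒜 m n q k) ∧
    ∀ T : Kriz.ForestType n ι,
      -- each type subspace is stable under the symmetric group
      (∀ (σ : Equiv.Perm (Fin n)), ∀ e ∈ Kriz.typeSubspace 𝒜 x T,
        Kriz.action 𝒜 n σ e ∈ Kriz.typeSubspace 𝒜 x T) ∧
      -- it is generated, as a module over the group, by the monomial of the marked bamboos
      Submodule.span K (Set.range fun σ : Equiv.Perm (Fin n) =>
        Kriz.action 𝒜 n σ (Kriz.monomial 𝒜 x T.bamboo)) = Kriz.typeSubspace 𝒜 x T ∧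
      -- it is a direct sum of irreducible submodules, with multiplicities at most the dimensions
      (∃ (r : ℕ) (W : Fin r → Subrepresentation (Kriz.action 𝒜 n)),
        Kriz.IsIrreducibleDecomposition (Kriz.action 𝒜 n) (Kriz.typeSubspace 𝒜 x T) W) ∧
      ∀ (r : ℕ) (W : Fin r → Subrepresentation (Kriz.action 𝒜 n)),
        Kriz.IsIrreducibleDecomposition (Kriz.action 𝒜 n) (Kriz.typeSubspace 𝒜 x T) W →
        ∀ (V : Type*) [AddCommGroup V] [Module K V]
          (θ : Representation K (Equiv.Perm (Fin n)) V), θ.IsIrreducible →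
          Kriz.multiplicity W θ ≤ Module.finrank K V := by
  have hlin := Kriz.linearIndependent_monomial (n := n) hcomm x.linearIndependent hdeg
  refine ⟨fun q k => ⟨(Kriz.iSupIndep_typeSubspace hlin).comp Subtype.val_injective,
    le_antisymm (iSup_le fun T => Kriz.typeSubspace_le_component hdeg m T.2.1 T.2.2)
      (Kriz.component_le_iSup hcomm x hdeg m q k)⟩, fun T => ?_⟩
  have hspan := Kriz.span_orbit_bamboo hcomm hdeg T
  refine ⟨fun σ e he => Kriz.action_mem_typeSubspace hcomm hdeg T σ he, hspan, ?_, ?_⟩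
  · have : FiniteDimensional K (Kriz.typeSubspace 𝒜 x T) := by
      rw [← hspan]
      exact FiniteDimensional.span_of_finite K (Set.finite_range _)
    exact Kriz.exists_isIrreducibleDecomposition (Kriz.action 𝒜 n)
      ⟨Kriz.typeSubspace 𝒜 x T, fun σ e he => Kriz.action_mem_typeSubspace hcomm hdeg T σ he⟩
  · intro r W hW V _ _ θ hθ
    rw [← hspan] at hW
    exact Kriz.multiplicity_le_finrank hW hθ
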